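/- **Setting.** Let $M\ge 1$, $N=M+1$, and let $P_1,\dots,P_{N}$ be points of the plane with $P_j\ne P_{j+1}$ ($1\le j\le M$) and $P_{j-1}\neq P_{j+1}$ ($2\le j\le M$); let $\tau_1,\tau_{N}$ be two angles and $\mathbf n(\varphi)=(\cos\varphi,\sin\varphi)$. For $1\le j\le M$ put $2c_j=|P_jP_{j+1}|$ and let $\mu_j$ be the direction angle of $P_jP_{j+1}$; put $c_0=c_{N}=0$, $\mu_0=\tau_1$, $\mu_{N}=\tau_{N}$. For $1\le j\le N$ let $\rho_j\in(-\pi,\pi]$, $\rho_j\equiv\mu_j-\mu_{j-1}\pmod{2\pi}$, and $d_j=\sqrt{c_{j-1}^2+2c_{j-1}c_j\cos\rho_j+c_j^2}$. Assume $c_{j-1}+c_j\cos\rho_j\ge0$ and $c_j+c_{j-1}\cos\rho_j\ge 0$ for $1\le j\le N$. For $1\le j\le M$ define the angles $\xi_j,\eta_j\in[-\frac\pi2,\frac\pi2]$ by $$\sin\xi_j=-\frac{c_j\sin\rho_j}{d_j},\quad \cos\xi_j=\frac{c_{j-1}+c_j\cos\rho_j}{d_j},\quad \sin\eta_j=\frac{c_j\sin\rho_{j+1}}{d_{j+1}},\quad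 \cos\eta_j=\frac{c_{j+1}+c_j\cos\rho_{j+1}}{d_{j+1}} .$$ **Spiral.** Let a plane curve, parametrized by arc length, with continuous tangent angle and nondecreasing signed curvature, pass through $P_1,\dots,P_{N}$ in this order, starting at $P_1$ with tangent $\mathbf n(\tau_1)$ and ending at $P_N$ with tangent $\mathbf n(\tau_{N})$, and let each segment of it between $P_j$ and $P_{j+1}$ project one-to-one onto the line of the chord $P_jP_{j+1}$. In the coordinates in which this chord is the segment $[-c_j,c_j]$ of the $x$-axis, directed from $P_j$ to $P_{j+1}$, the $j$-th segment is the graph $y=f_j(x)$, $|x|\le c_j$. Let $\alpha_j,\beta_j\in(-\pi,\pi]$ be the angles of its start and end tangents with respect to the chord, and $\kappa_j$ its curvature. **Short biarcs.** For $c>0$, $|\varphi|\le\frac\pi2$ let $A(x;c,\varphi)$, $|x|\le c$, be the circular arc over $[-c,c]$ with start tangent $\mathbf n(\varphi)$: $A(x;c,\varphi)=\dfrac{(c^2-x^2)\sin\varphi}{c\cos\varphi+\sqrt{c^2-x^2\sin^2\varphi}}$ for $|x|<c$, and $A(\pm c;c,\varphi)=0$. For $|\alpha|,|\beta|\le\frac\pi2$,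 $\omega=\frac{\alpha+\beta}2\ne0$, $0<p<\infty$, let $B_0(x;c,\alpha,\beta,p)$, $|x|\le c$, be the biarc, as a function of $x$, consisting of a circular (or straight) arc that starts at $(-c,0)$ with tangent $\mathbf n(\alpha)$ and has curvature $-\frac1c\left(\sin\alpha+\frac1p\sin\omega\right)$, smoothly continued by an arc of curvature $\frac1c(\sin\beta+p\sin\omega)$ that ends at $(c,0)$ with tangent $\mathbf n(\beta)$. The degenerate biarcs are $B_0(x;c,\alpha,\beta,0)=A(x;c,-\beta)$ and $B_0(x;c,\alpha,\beta,\infty)=A(x;c,\alpha)$ if $\alpha+\beta\neq0$, and $B_0(x;c,\alpha,-\alpha,p)=A(x;c,\alpha)$ for every $p$. **Table.** For $1\le j\le M$ let $$\alpha'_1=\xi_1,\quad \alpha'_j=\max(-\rho_j-\xi_{j-1},-\eta_j)\ (j>1),\quad \alpha''_j=\xi_j,$$ $$\beta'_M=\eta_M,\quad \beta'_j=\max(-\xi_j,\rho_{j+1}-\eta_{j+1})\ (j<M),\quad \beta''_j=\eta_j,$$ $$a_1=-\infty,\quad a_j=\frac{\sin\beta'_{j-1}}{c_{j-1}}\ (j>1),\qquad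 b_M=+\infty,\quad b_j=-\frac{\sin\alpha'_{j+1}}{c_{j+1}}\ (j<M),$$ $$p'_j=-\frac{\sin\frac{\alpha'_j+\beta''_j}2}{a_jc_j+\sin\alpha'_j},\qquad p''_j=\frac{b_jc_j-\sin\beta'_j}{\sin\frac{\alpha''_j+\beta'_j}2},$$ where $p'_1=0$ and $p''_M=\infty$, a positive number divided by $0$ is $\infty$, and $p'_j$ (resp. $p''_j$) is irrelevant if $\alpha'_j+\beta''_j=0$ (resp. $\alpha''_j+\beta'_j=0$). **Proposition 5.** For every $j=1,\dots,M$: 1. $\alpha'_j\le\alpha_j\le\alpha''_j$, $\ \beta'_j\le\beta_j\le\beta''_j$, and $a_j\le\kappa_j\le b_j$ along the whole $j$-th segment, end nodes included; 2. $\alpha'_j,\alpha''_j,\beta'_j,\beta''_j\in[-\frac\pi2,\frac\pi2]$, $\ \alpha'_j+\beta''_j\ge0$, $\ \alpha''_j+\beta'_j\ge0$, $\ a_jc_j+\sin\alpha'_j\le0\le b_jc_j-\sin\beta'_j$, so that the two biarcs below are (possibly degenerate) short biarcs with parameters in $[0,\infty]$; 3. for all $x\in[-c_j,c_j]$, $$B_0(x;c_j,\alpha'_j,\beta''_j,p'_j)\le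 f_j(x)\le B_0(x;c_j,\alpha''_j,\beta'_j,p''_j).$$ -/

import Mathlib

open Set

noncomputable section

/-! The Euclidean plane is identified with `ℂ`; the unit vector of angle `φ` is `exp (φ * I)`. -/

/-! ### Circular arcs and short biarcs over the segment `[-c, c]` -/

/-- `A(x; c, φ)`: the circular arc resting on the segment `[-c, c]` of the `x`-axis, with start
tangent of angle `φ`, as a function of `x` (for `|φ| ≤ π / 2`). -/
def lensArc (c φ x : ℝ) : ℝ :=
  (c ^ 2 - x ^ 2) * Real.sin φ / (c * Real.cos φ + √(c ^ 2 - x ^ 2 * Real.sin φ ^ 2))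

/-- The circular arc (or line) through the point `(x₀, 0)` with tangent angle `φ` there
and signed curvature `k`, as a function of `x`.  Along it the tangent angle `ψ` satisfies
`sin ψ = sin φ + k * (x - x₀)` and `cos ψ ≥ 0`. -/
def arcThrough (x₀ φ k x : ℝ) : ℝ :=
  (x - x₀) * (2 * Real.sin φ + k * (x - x₀)) /
    (Real.cos φ + √(1 - (Real.sin φ + k * (x - x₀)) ^ 2))

/-- Start curvature of the short biarc with parameter `p`. -/
def biarcStartCurv (c α β p : ℝ) : ℝ :=
  -(Real.sin α + Real.sin ((α + β) / 2) / p) / c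

/-- End curvature of the short biarc with parameter `p`. -/
def biarcEndCurv (c α β p : ℝ) : ℝ :=
  (Real.sin β + p * Real.sin ((α + β) / 2)) / c

/-- Abscissa of the join point of the biarc: the point where the two arcs have the same slope,
i.e. where `sin α + a (x + c) = sin β + b (x - c)`. -/
def biarcJoin (c α β p : ℝ) : ℝ :=
  (Real.sin α - Real.sin β + (biarcStartCurv c α β p + biarcEndCurv c α β p) * c) /
    (biarcEndCurv c α β p - biarcStartCurv c α β p)

/-- `B₀(x; c, α, β, p)`, `p ∈ [0, ∞]`: the short biarc from `(-c, 0)` to `(c, 0)` with end tangent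
angles `α`, `β` (for `|α|, |β| ≤ π / 2`), including the degenerate ones
(`p = 0`, `p = ∞` or `α + β = 0`), which are single arcs. -/
def shortBiarc (c α β : ℝ) (p : ENNReal) (x : ℝ) : ℝ :=
  if α + β = 0 ∨ p = ⊤ then lensArc c α x
  else if p = 0 then lensArc c (-β) x
  else if x ≤ biarcJoin c α β p.toReal then
    arcThrough (-c) α (biarcStartCurv c α β p.toReal) x
  else arcThrough c β (biarcEndCurv c α β p.toReal) x

/-! ### Spiral data -/

/-- Interpolation data: the points `P 1, …, P (M + 1)` (other values of `P` are irrelevant) and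
the angles of the tangents prescribed at the first and at the last point. -/
structure SplineData where
  M : ℕ
  P : ℕ → ℂ
  tauFirst : ℝ
  tauLast : ℝ

namespace SplineData

variable (D : SplineData)

/-- Half-length `c_j` of the `j`-th chord, with `c_0 = c_{M+1} = 0`. -/
def c (j : ℕ) : ℝ :=
  if 1 ≤ j ∧ j ≤ D.M then ‖D.P (j + 1) - D.P j‖ / 2 else 0

/-- Direction `μ_j` of the `j`-th chord; `μ_0` and `μ_{M+1}` are the prescribed tangents. -/
def mu (j : ℕ) : ℝ :=
  if j = 0 then D.tauFirst
  else if j = D.M + 1 then D.tauLast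
  else Complex.arg (D.P (j + 1) - D.P j)

/-- Turning angle `ρ_j = μ_j - μ_{j-1}` at the `j`-th node, taken in `(-π, π]`. -/
def rho (j : ℕ) : ℝ := ((D.mu j - D.mu (j - 1) : ℝ) : Real.Angle).toReal

/-- `d_j`, half the distance between `P_{j-1}` and `P_{j+1}`. -/
def d (j : ℕ) : ℝ :=
  √(D.c (j - 1) ^ 2 + 2 * D.c (j - 1) * D.c j * Real.cos (D.rho j) + D.c j ^ 2)

/-- `ξ_j`: the tangent at `P_j` to the circular arc `P_{j-1} P_j P_{j+1}`, measured from the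
direction of the `j`-th chord. -/
def xi (j : ℕ) : ℝ :=
  Complex.arg ⟨(D.c (j - 1) + D.c j * Real.cos (D.rho j)) / D.d j,
    -(D.c j * Real.sin (D.rho j)) / D.d j⟩

/-- `η_j`: the tangent at `P_{j+1}` to the circular arc `P_j P_{j+1} P_{j+2}`, measured from the
direction of the `j`-th chord. -/
def eta (j : ℕ) : ℝ :=
  Complex.arg ⟨(D.c (j + 1) + D.c j * Real.cos (D.rho (j + 1))) / D.d (j + 1),
    D.c j * Real.sin (D.rho (j + 1)) / D.d (j + 1)⟩

/-- Standing assumptions on the data: consecutive points are distinct, any three consecutive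
points are distinct, and neither of the two arcs `P_{j-1} P_j`, `P_j P_{j+1}` of the circle
through three consecutive points exceeds a half-circle. -/
structure Admissible : Prop where
  one_le : 1 ≤ D.M
  ne_succ : ∀ j, 1 ≤ j → j ≤ D.M → D.P j ≠ D.P (j + 1)
  ne_succ_succ : ∀ j, 2 ≤ j → j ≤ D.M → D.P (j - 1) ≠ D.P (j + 1)
  half_circle : ∀ j, 1 ≤ j → j ≤ D.M + 1 →
    0 ≤ D.c (j - 1) + D.c j * Real.cos (D.rho j) ∧
    0 ≤ D.c j + D.c (j - 1) * Real.cos (D.rho j)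

/-- Local coordinates of the `j`-th chord: the chord becomes the segment `[-c_j, c_j]` of the
real axis. -/
def toLocal (j : ℕ) (z : ℂ) : ℂ :=
  (z - (D.P j + D.P (j + 1)) / 2) * Complex.exp (-(D.mu j : ℂ) * Complex.I)

/-! ### The table of tangent ranges, curvature ranges and biarc parameters -/

/-- `α'_j` -/
def alphaMin (j : ℕ) : ℝ :=
  if j = 1 then D.xi 1 else max (-D.rho j - D.xi (j - 1)) (-D.eta j)

/-- `α''_j` -/
def alphaMax (j : ℕ) : ℝ := D.xi j

/-- `β'_j` -/
def betaMin (j : ℕ) : ℝ :=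
  if j = D.M then D.eta D.M else max (-D.xi j) (D.rho (j + 1) - D.eta (j + 1))

/-- `β''_j` -/
def betaMax (j : ℕ) : ℝ := D.eta j

/-- `a_j`, the lower bound for the curvature -/
def curvMin (j : ℕ) : EReal :=
  if j = 1 then ⊥ else ((Real.sin (D.betaMin (j - 1)) / D.c (j - 1) : ℝ) : EReal)

/-- `b_j`, the upper bound for the curvature -/
def curvMax (j : ℕ) : EReal :=
  if j = D.M then ⊤ else ((-(Real.sin (D.alphaMin (j + 1)) / D.c (j + 1)) : ℝ) : EReal)

/-- `p'_j = - sin ω / (a_j c_j + sin α'_j)` with `ω = (α'_j + β''_j) / 2`, in `[0, ∞]`. -/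
def pLower (j : ℕ) : ENNReal :=
  ENNReal.ofReal (Real.sin ((D.alphaMin j + D.betaMax j) / 2)) /
    (-(D.curvMin j * (D.c j : EReal) + (Real.sin (D.alphaMin j) : EReal))).toENNReal

/-- `p''_j = (b_j c_j - sin β'_j) / sin ω` with `ω = (α''_j + β'_j) / 2`, in `[0, ∞]`. -/
def pUpper (j : ℕ) : ENNReal :=
  (D.curvMax j * (D.c j : EReal) - (Real.sin (D.betaMin j) : EReal)).toENNReal /
    ENNReal.ofReal (Real.sin ((D.alphaMax j + D.betaMin j) / 2))

end SplineData

/-! ### Spirals -/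

/-- `γ` restricted to `[s₀, s₁]` is a plane curve parametrized by arc length, with continuous
tangent angle `θ` and with nondecreasing signed curvature `k` (possibly discontinuous). -/
structure IsSpiral (γ : ℝ → ℂ) (θ k : ℝ → ℝ) (s₀ s₁ : ℝ) : Prop where
  hasDeriv : ∀ s ∈ Icc s₀ s₁,
    HasDerivWithinAt γ (Complex.exp ((θ s : ℂ) * Complex.I)) (Icc s₀ s₁) s
  turning : ∀ s ∈ Icc s₀ s₁, θ s = θ s₀ + ∫ t in s₀..s, k t
  monotone : MonotoneOn k (Icc s₀ s₁)

/-- `γ`, with tangent angle `θ`, passes at the increasing parameter values `s 1 < ⋯ < s (M + 1)`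
through the points of `D`, has the prescribed end tangents, and each of its segments between
neighbouring nodes projects one-to-one onto the chord. -/
structure SplineData.Interpolates (D : SplineData) (s : ℕ → ℝ) (γ : ℝ → ℂ) (θ : ℝ → ℝ) :
    Prop where
  node_lt : ∀ j, 1 ≤ j → j ≤ D.M → s j < s (j + 1)
  node_eq : ∀ j, 1 ≤ j → j ≤ D.M + 1 → γ (s j) = D.P j
  first_tangent : (θ (s 1) : Real.Angle) = (D.tauFirst : Real.Angle)
  last_tangent : (θ (s (D.M + 1)) : Real.Angle) = (D.tauLast : Real.Angle)
  projectable : ∀ j, 1 ≤ j → j ≤ D.M →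
    InjOn (fun t => (D.toLocal j (γ t)).re) (Icc (s j) (s (j + 1)))

/-- `α_j`: the tangent angle of the curve at the start of the `j`-th segment, measured from the
direction of the `j`-th chord, in `(-π, π]`. -/
def SplineData.alpha (D : SplineData) (s : ℕ → ℝ) (θ : ℝ → ℝ) (j : ℕ) : ℝ :=
  ((θ (s j) - D.mu j : ℝ) : Real.Angle).toReal

/-- `β_j`: the same at the end of the `j`-th segment. -/
def SplineData.beta (D : SplineData) (s : ℕ → ℝ) (θ : ℝ → ℝ) (j : ℕ) : ℝ :=
  ((θ (s (j + 1)) - D.mu j : ℝ) : Real.Angle).toReal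

end

/-! ### Circular arcs -/

/-! Along a curve with tangent angle `φ` in `[-π/2, π/2]` and curvature `k`, parametrized by arc
length, `d(sin φ) = k cos φ ds = k dx`. Nondecreasing curvature therefore means that `sin φ` is a
convex function of `x` with slope `k`, while for a circular arc it is affine. The sign of the slope
difference between spiral and arc is the sign of the difference of the two sines, and convex minus
affine is quasiconvex. Every comparison of ordinates thus reduces to comparing a convex function
with a line.

On one chord, both ends have ordinate zero. A support line at an end gives the curvature bounds
`sin_div_le_curv_right` and `curv_left_le`; comparing a convex function with its secant gives Vogt's
inequality `0 ≤ α + β` (`angle_add_nonneg`). A biarc below the spiral is handled arc by arc: its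
first arc starts lower and with smaller curvature, so it stays below the support line at the start;
its second arc lies below the spiral at the join and at the end, and `arc_le_of_ends` fills the gap
(`biarc_le`). Upper bounds follow by the half-turn `mirror`.

At an inner node, `β_j - α_{j+1} = ρ_{j+1} = η_j - ξ_{j+1}`, and `sin β_j / c_j ≤ κ ≤ -sin α_{j+1} /
c_{j+1}`, with equality of the outer terms for the circle angles `η_j`, `ξ_{j+1}`. Increasing both
angles together raises the left side and lowers the right one, so `α_{j+1} ≤ ξ_{j+1}` and `β_j ≤
η_j` (`node_bounds`). Vogt's inequality turns these upper bounds into the lower bounds of the table,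
and these into curvature bounds. The parameters `p'`, `p''` are those for which the biarc has start
curvature `a_j`, respectively end curvature `b_j`. -/

theorem arcThrough_self (x₀ φ k : ℝ) : arcThrough x₀ φ k x₀ = 0 := by simp [arcThrough]

theorem arcThrough_eq_of_ne_zero {x₀ φ k x : ℝ} (hk : k ≠ 0) (hφ : 0 ≤ Real.cos φ)
    (h : |Real.sin φ + k * (x - x₀)| ≤ 1) :
    arcThrough x₀ φ k x = (Real.cos φ - √(1 - (Real.sin φ + k * (x - x₀)) ^ 2)) / k := by
  have hq : √(1 - (Real.sin φ + k * (x - x₀)) ^ 2) ^ 2 = 1 - (Real.sin φ + k * (x - x₀)) ^ 2 :=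
    Real.sq_sqrt (by have := (sq_le_one_iff_abs_le_one _).2 h; linarith)
  have hq0 := Real.sqrt_nonneg (1 - (Real.sin φ + k * (x - x₀)) ^ 2)
  have hsc := Real.sin_sq_add_cos_sq φ
  unfold arcThrough
  generalize √(1 - (Real.sin φ + k * (x - x₀)) ^ 2) = q at *
  -- If the denominator vanishes, `cos φ = q = 0`, and both sides are zero.
  by_cases hz : Real.cos φ + q = 0
  · have h1 : Real.cos φ = 0 := by linarith
    have h2 : q = 0 := by linarith
    simp [h1, h2]
  · rw [div_eq_div_iff hz hk]
    linear_combination -hsc + hq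

theorem arcThrough_hasDerivAt {x₀ φ k x : ℝ} (hφ : 0 ≤ Real.cos φ)
    (h : |Real.sin φ + k * (x - x₀)| < 1) :
    HasDerivAt (arcThrough x₀ φ k)
      ((Real.sin φ + k * (x - x₀)) / √(1 - (Real.sin φ + k * (x - x₀)) ^ 2)) x := by
  have hpos : 0 < 1 - (Real.sin φ + k * (x - x₀)) ^ 2 := by
    have := (sq_lt_one_iff_abs_lt_one _).2 h; linarith
  by_cases hk : k = 0
  · subst hk
    have hc : √(1 - Real.sin φ ^ 2) = Real.cos φ := by
      rw [← Real.cos_sq', Real.sqrt_sq hφ]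
    have hc0 : 0 < Real.cos φ := by
      rw [← hc]; apply Real.sqrt_pos.2; simpa using hpos
    have e : arcThrough x₀ φ 0 = fun z => Real.sin φ / Real.cos φ * (z - x₀) := by
      funext z
      simp only [arcThrough, zero_mul, add_zero, hc]
      field_simp
      ring
    rw [e]
    simp only [zero_mul, add_zero, hc]
    simpa using ((hasDerivAt_id x).sub_const x₀).const_mul (Real.sin φ / Real.cos φ)
  · have hlam : HasDerivAt (fun z => Real.sin φ + k * (z - x₀)) k x := by
      simpa using (((hasDerivAt_id x).sub_const x₀).const_mul k).const_add (Real.sin φ)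
    have h1 := (((hlam.pow 2).const_sub 1).sqrt hpos.ne').const_sub (Real.cos φ) |>.div_const k
    have h2 : (fun z => (Real.cos φ - √(1 - (Real.sin φ + k * (z - x₀)) ^ 2)) / k)
        =ᶠ[nhds x] arcThrough x₀ φ k := by
      have := hlam.continuousAt.abs.eventually (gt_mem_nhds h)
      filter_upwards [this] with z hz
      exact (arcThrough_eq_of_ne_zero hk hφ (le_of_lt hz)).symm
    refine (h1.congr_of_eventuallyEq h2.symm).congr_deriv ?_
    have := Real.sqrt_pos.2 hpos
    simp only [Nat.cast_ofNat, Nat.add_one_sub_one, pow_one, Pi.pow_apply]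
    field_simp

/-- The alternative on `k` excludes the vertical line, `k = 0` and `cos φ = 0`, where the
denominator of `arcThrough` is identically zero. -/
theorem arcThrough_continuousOn {x₀ φ k : ℝ} (hφ : 0 ≤ Real.cos φ) (hk : k ≠ 0 ∨ 0 < Real.cos φ) :
    ContinuousOn (arcThrough x₀ φ k) {x | |Real.sin φ + k * (x - x₀)| ≤ 1} := by
  rcases hk with hk | hc
  · have : ContinuousOn (fun x => (Real.cos φ - √(1 - (Real.sin φ + k * (x - x₀)) ^ 2)) / k)
        {x | |Real.sin φ + k * (x - x₀)| ≤ 1} := by fun_prop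
    exact this.congr fun x hx => arcThrough_eq_of_ne_zero hk hφ hx
  · unfold arcThrough
    refine ContinuousOn.div (by fun_prop) (by fun_prop) fun x _ => ?_
    have := Real.sqrt_nonneg (1 - (Real.sin φ + k * (x - x₀)) ^ 2)
    positivity

theorem arcThrough_neg (x₀ φ k x : ℝ) : arcThrough (-x₀) φ (-k) (-x) = -arcThrough x₀ φ k x := by
  unfold arcThrough
  rw [← neg_div]
  ring_nf

theorem lensArc_eq_arcThrough_left {c : ℝ} (hc : 0 < c) (φ x : ℝ) :
    lensArc c φ x = arcThrough (-c) φ (-(Real.sin φ / c)) x := by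
  unfold lensArc arcThrough
  have h1 : Real.sin φ + -(Real.sin φ / c) * (x - -c) = -(x * Real.sin φ) / c := by
    field_simp; ring
  have h2 : √(c ^ 2 - x ^ 2 * Real.sin φ ^ 2) = c * √(1 - (-(x * Real.sin φ) / c) ^ 2) := by
    have : c ^ 2 - x ^ 2 * Real.sin φ ^ 2 = c ^ 2 * (1 - (-(x * Real.sin φ) / c) ^ 2) := by
      field_simp
    rw [this, Real.sqrt_mul (sq_nonneg c), Real.sqrt_sq hc.le]
  rw [h1, h2, ← mul_add]
  have h3 : (x - -c) * (2 * Real.sin φ + -(Real.sin φ / c) * (x - -c))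
      = (c ^ 2 - x ^ 2) * Real.sin φ / c := by field_simp; ring
  rw [h3, div_div]

theorem lensArc_neg_eq_arcThrough_right {c : ℝ} (hc : 0 < c) (φ x : ℝ) :
    lensArc c (-φ) x = arcThrough c φ (Real.sin φ / c) x := by
  have h := arcThrough_neg c φ (Real.sin φ / c) x
  rw [← lensArc_eq_arcThrough_left hc] at h
  rw [← neg_eq_iff_eq_neg.2 h, ← neg_eq_iff_eq_neg]
  simp [lensArc, neg_div]

/-! ### Comparing sines -/

/-- With `l = sin ψ`, this is `0 ≤ sin (φ - ψ)` divided by `cos ψ`. It is `tan ψ ≤ tan φ` multiplied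
by `cos φ`, so that vertical tangents `cos φ = 0` are allowed. -/
theorem div_sqrt_mul_cos_le_sin {φ l : ℝ} (hφ : φ ∈ Icc (-(Real.pi / 2)) (Real.pi / 2))
    (hl : |l| < 1) (h : l ≤ Real.sin φ) : l / √(1 - l ^ 2) * Real.cos φ ≤ Real.sin φ := by
  obtain ⟨h1, h2⟩ := abs_lt.1 hl
  have hpos : 0 < √(1 - l ^ 2) := Real.sqrt_pos.2 (by nlinarith)
  have hle : Real.arcsin l ≤ φ := by
    rw [← Real.arcsin_sin hφ.1 hφ.2]; exact Real.monotone_arcsin h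
  have hs : 0 ≤ Real.sin (φ - Real.arcsin l) :=
    Real.sin_nonneg_of_nonneg_of_le_pi (by linarith)
      (by linarith [hφ.2, Real.neg_pi_div_two_le_arcsin l])
  rw [Real.sin_sub, Real.cos_arcsin, Real.sin_arcsin h1.le h2.le] at hs
  rw [div_mul_eq_mul_div, div_le_iff₀ hpos]
  linarith

theorem div_sqrt_mul_cos_lt_sin {φ l : ℝ} (hφ : φ ∈ Icc (-(Real.pi / 2)) (Real.pi / 2))
    (hl : |l| < 1) (h : l < Real.sin φ) : l / √(1 - l ^ 2) * Real.cos φ < Real.sin φ := by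
  obtain ⟨h1, h2⟩ := abs_lt.1 hl
  have hpos : 0 < √(1 - l ^ 2) := Real.sqrt_pos.2 (by nlinarith)
  have hle : Real.arcsin l < φ := (Real.arcsin_lt_iff_lt_sin' ⟨by
    rcases lt_or_eq_of_le hφ.1 with h3 | h3
    · exact h3
    · rw [← h3, Real.sin_neg, Real.sin_pi_div_two] at h; linarith, hφ.2⟩).2 h
  have hs : 0 < Real.sin (φ - Real.arcsin l) :=
    Real.sin_pos_of_pos_of_lt_pi (by linarith)
      (by linarith [hφ.2, Real.neg_pi_div_two_lt_arcsin.2 h1])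
  rw [Real.sin_sub, Real.cos_arcsin, Real.sin_arcsin h1.le h2.le] at hs
  rw [div_mul_eq_mul_div, div_lt_iff₀ hpos]
  linarith

theorem sin_le_div_sqrt_mul_cos {φ l : ℝ} (hφ : φ ∈ Icc (-(Real.pi / 2)) (Real.pi / 2))
    (hl : |l| < 1) (h : Real.sin φ ≤ l) : Real.sin φ ≤ l / √(1 - l ^ 2) * Real.cos φ := by
  have := div_sqrt_mul_cos_le_sin (φ := -φ) (l := -l) ⟨by linarith [hφ.2], by linarith [hφ.1]⟩
    (by rwa [abs_neg]) (by rw [Real.sin_neg]; linarith)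
  rw [neg_sq, Real.cos_neg, Real.sin_neg, neg_div, neg_mul] at this
  linarith

theorem sin_lt_div_sqrt_mul_cos {φ l : ℝ} (hφ : φ ∈ Icc (-(Real.pi / 2)) (Real.pi / 2))
    (hl : |l| < 1) (h : Real.sin φ < l) : Real.sin φ < l / √(1 - l ^ 2) * Real.cos φ := by
  have := div_sqrt_mul_cos_lt_sin (φ := -φ) (l := -l) ⟨by linarith [hφ.2], by linarith [hφ.1]⟩
    (by rwa [abs_neg]) (by rw [Real.sin_neg]; linarith)
  rw [neg_sq, Real.cos_neg, Real.sin_neg, neg_div, neg_mul] at this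
  linarith

/-- An affine function with values in `[-1, 1]` at the ends of an interval has values in `(-1, 1)`
inside, unless it is constantly `1` or `-1`. -/
theorem abs_affine_lt_one {x₀ φ m u v x : ℝ} (hm : m ≠ 0 ∨ 0 < Real.cos φ)
    (hu : |Real.sin φ + m * (u - x₀)| ≤ 1) (hv : |Real.sin φ + m * (v - x₀)| ≤ 1)
    (hux : u < x) (hxv : x < v) : |Real.sin φ + m * (x - x₀)| < 1 := by
  rw [abs_le] at hu hv
  rcases lt_trichotomy m 0 with h | h | h
  · rw [abs_lt]; constructor <;> nlinarith
  · subst h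
    have hc : 0 < Real.cos φ := by simpa using hm
    simp only [zero_mul, add_zero]
    rw [← sq_lt_one_iff_abs_lt_one]
    nlinarith [Real.sin_sq_add_cos_sq φ]
  · rw [abs_lt]; constructor <;> nlinarith

/-! ### Spirals over a chord -/

/-- The curve `(x, y)`, with tangent angle `φ ∈ [-π / 2, π / 2]` and nondecreasing curvature `k`,
joins `(-c, 0)` to `(c, 0)` and is projectable onto the `x`-axis.  The field `support` says that
`sin φ` is a convex function of `x` with slope `k`. -/
structure ChordSpiral (c a b : ℝ) (x y φ k : ℝ → ℝ) : Prop where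
  lt : a < b
  x_deriv : ∀ t ∈ Icc a b, HasDerivWithinAt x (Real.cos (φ t)) (Icc a b) t
  y_deriv : ∀ t ∈ Icc a b, HasDerivWithinAt y (Real.sin (φ t)) (Icc a b) t
  strictMono : StrictMonoOn x (Icc a b)
  angle_mem : ∀ t ∈ Icc a b, φ t ∈ Icc (-(Real.pi / 2)) (Real.pi / 2)
  monotone : MonotoneOn k (Icc a b)
  support : ∀ t₀ ∈ Icc a b, ∀ t ∈ Icc a b,
    Real.sin (φ t₀) + k t₀ * (x t - x t₀) ≤ Real.sin (φ t)
  x_left : x a = -c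
  x_right : x b = c
  y_left : y a = 0
  y_right : y b = 0

namespace ChordSpiral

variable {c a b : ℝ} {x y φ k : ℝ → ℝ}

theorem left_mem (h : ChordSpiral c a b x y φ k) : a ∈ Icc a b := ⟨le_rfl, h.lt.le⟩

theorem right_mem (h : ChordSpiral c a b x y φ k) : b ∈ Icc a b := ⟨h.lt.le, le_rfl⟩

theorem c_pos (h : ChordSpiral c a b x y φ k) : 0 < c := by
  have := h.strictMono h.left_mem h.right_mem h.lt
  rw [h.x_left, h.x_right] at this
  linarith

/-- Rotation by `π` combined with reversal of the direction. -/
theorem mirror (h : ChordSpiral c a b x y φ k) :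
    ChordSpiral c (-b) (-a) (fun t => -x (-t)) (fun t => -y (-t)) (fun t => φ (-t))
      (fun t => -k (-t)) := by
  have hm : ∀ t ∈ Icc (-b) (-a), -t ∈ Icc a b := fun t ht =>
    ⟨by linarith [ht.2], by linarith [ht.1]⟩
  have key : ∀ {z : ℝ → ℝ} {z' t : ℝ}, -t ∈ Icc a b → HasDerivWithinAt z z' (Icc a b) (-t) →
      HasDerivWithinAt (fun t => -z (-t)) z' (Icc (-b) (-a)) t := by
    intro z z' t _ hz
    have := (hz.scomp t ((hasDerivAt_id t).neg.hasDerivWithinAt (s := Icc (-b) (-a)))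
      (fun u hu => hm u hu)).neg
    simp only [neg_smul, one_smul, neg_neg] at this
    exact this
  refine ⟨by linarith [h.lt], fun t ht => key (hm t ht) (h.x_deriv _ (hm t ht)),
    fun t ht => key (hm t ht) (h.y_deriv _ (hm t ht)), ?_, fun t ht => h.angle_mem _ (hm t ht),
    ?_, ?_, by simp [h.x_right], by simp [h.x_left], by simp [h.y_right], by simp [h.y_left]⟩
  · intro t ht u hu htu
    exact neg_lt_neg (h.strictMono (hm u hu) (hm t ht) (neg_lt_neg htu))
  · intro t ht u hu htu
    exact neg_le_neg (h.monotone (hm u hu) (hm t ht) (neg_le_neg htu))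
  · intro t₀ ht₀ t ht
    have := h.support _ (hm t₀ ht₀) _ (hm t ht)
    linarith

/-! ### Comparing a spiral with a single arc -/

variable {x₀ ψ m t₁ t₂ : ℝ}

theorem abs_line_lt_one (h : ChordSpiral c a b x y φ k) (hm : m ≠ 0 ∨ 0 < Real.cos ψ)
    (ht₁ : t₁ ∈ Icc a b) (ht₂ : t₂ ∈ Icc a b)
    (h₁ : |Real.sin ψ + m * (x t₁ - x₀)| ≤ 1) (h₂ : |Real.sin ψ + m * (x t₂ - x₀)| ≤ 1)
    {t : ℝ} (ht : t ∈ Ioo t₁ t₂) : |Real.sin ψ + m * (x t - x₀)| < 1 := by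
  have htm : t ∈ Icc a b := ⟨ht₁.1.trans ht.1.le, ht.2.le.trans ht₂.2⟩
  exact abs_affine_lt_one hm h₁ h₂ (h.strictMono ht₁ htm ht.1) (h.strictMono htm ht₂ ht.2)

theorem hasDerivAt_sub_arc (h : ChordSpiral c a b x y φ k) (hψ : 0 ≤ Real.cos ψ) {t : ℝ}
    (ht : t ∈ Ioo a b) (hl : |Real.sin ψ + m * (x t - x₀)| < 1) :
    HasDerivAt (fun t => y t - arcThrough x₀ ψ m (x t))
      (Real.sin (φ t) - (Real.sin ψ + m * (x t - x₀)) /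
        √(1 - (Real.sin ψ + m * (x t - x₀)) ^ 2) * Real.cos (φ t)) t := by
  have hn := Icc_mem_nhds ht.1 ht.2
  have hx := (h.x_deriv t (Ioo_subset_Icc_self ht)).hasDerivAt hn
  have hy := (h.y_deriv t (Ioo_subset_Icc_self ht)).hasDerivAt hn
  exact hy.sub ((arcThrough_hasDerivAt hψ hl).comp t hx)

theorem continuousOn_sub_arc (h : ChordSpiral c a b x y φ k) (hψ : 0 ≤ Real.cos ψ)
    (hm : m ≠ 0 ∨ 0 < Real.cos ψ) (ht₁ : t₁ ∈ Icc a b) (ht₂ : t₂ ∈ Icc a b)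
    (h₁ : |Real.sin ψ + m * (x t₁ - x₀)| ≤ 1) (h₂ : |Real.sin ψ + m * (x t₂ - x₀)| ≤ 1) :
    ContinuousOn (fun t => y t - arcThrough x₀ ψ m (x t)) (Icc t₁ t₂) := by
  have hs : Icc t₁ t₂ ⊆ Icc a b := Icc_subset_Icc ht₁.1 ht₂.2
  have hx : ContinuousOn x (Icc a b) := fun t ht => (h.x_deriv t ht).continuousWithinAt
  have hy : ContinuousOn y (Icc a b) := fun t ht => (h.y_deriv t ht).continuousWithinAt
  refine (hy.mono hs).sub ((arcThrough_continuousOn hψ hm).comp (hx.mono hs) fun t ht => ?_)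
  rcases eq_or_lt_of_le ht.1 with e | e
  · rw [← e]; exact h₁
  rcases eq_or_lt_of_le ht.2 with e' | e'
  · rw [e']; exact h₂
  exact (h.abs_line_lt_one hm ht₁ ht₂ h₁ h₂ ⟨e, e'⟩).le

/-- The derivative of `y - arc` is nonnegative wherever `sin φ` is above the line. Interior points
suffice, which matters because the arc may be vertical at the ends. -/
theorem sub_arc_le (h : ChordSpiral c a b x y φ k) (hψ : 0 ≤ Real.cos ψ)
    (hm : m ≠ 0 ∨ 0 < Real.cos ψ) (ht₁ : t₁ ∈ Icc a b) (ht₂ : t₂ ∈ Icc a b)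
    (h₁ : |Real.sin ψ + m * (x t₁ - x₀)| ≤ 1) (h₂ : |Real.sin ψ + m * (x t₂ - x₀)| ≤ 1)
    (hle : t₁ ≤ t₂) (H : ∀ t ∈ Ioo t₁ t₂, Real.sin ψ + m * (x t - x₀) ≤ Real.sin (φ t)) :
    y t₁ - arcThrough x₀ ψ m (x t₁) ≤ y t₂ - arcThrough x₀ ψ m (x t₂) := by
  refine monotoneOn_of_deriv_nonneg (convex_Icc t₁ t₂)
    (h.continuousOn_sub_arc hψ hm ht₁ ht₂ h₁ h₂) ?_ ?_ ⟨le_rfl, hle⟩ ⟨hle, le_rfl⟩ hle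
  all_goals
    rw [interior_Icc]
    intro t ht
    have htm : t ∈ Ioo a b := ⟨ht₁.1.trans_lt ht.1, ht.2.trans_le ht₂.2⟩
    have hl := h.abs_line_lt_one hm ht₁ ht₂ h₁ h₂ ht
    have hd := h.hasDerivAt_sub_arc hψ htm hl
  · exact hd.differentiableAt.differentiableWithinAt
  · rw [hd.deriv]
    exact sub_nonneg.2 (div_sqrt_mul_cos_le_sin (h.angle_mem t (Ioo_subset_Icc_self htm)) hl
      (H t ht))

theorem le_sub_arc (h : ChordSpiral c a b x y φ k) (hψ : 0 ≤ Real.cos ψ)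
    (hm : m ≠ 0 ∨ 0 < Real.cos ψ) (ht₁ : t₁ ∈ Icc a b) (ht₂ : t₂ ∈ Icc a b)
    (h₁ : |Real.sin ψ + m * (x t₁ - x₀)| ≤ 1) (h₂ : |Real.sin ψ + m * (x t₂ - x₀)| ≤ 1)
    (hle : t₁ ≤ t₂) (H : ∀ t ∈ Ioo t₁ t₂, Real.sin (φ t) ≤ Real.sin ψ + m * (x t - x₀)) :
    y t₂ - arcThrough x₀ ψ m (x t₂) ≤ y t₁ - arcThrough x₀ ψ m (x t₁) := by
  refine antitoneOn_of_deriv_nonpos (convex_Icc t₁ t₂)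
    (h.continuousOn_sub_arc hψ hm ht₁ ht₂ h₁ h₂) ?_ ?_ ⟨le_rfl, hle⟩ ⟨hle, le_rfl⟩ hle
  all_goals
    rw [interior_Icc]
    intro t ht
    have htm : t ∈ Ioo a b := ⟨ht₁.1.trans_lt ht.1, ht.2.trans_le ht₂.2⟩
    have hl := h.abs_line_lt_one hm ht₁ ht₂ h₁ h₂ ht
    have hd := h.hasDerivAt_sub_arc hψ htm hl
  · exact hd.differentiableAt.differentiableWithinAt
  · rw [hd.deriv]
    exact sub_nonpos.2 (sin_le_div_sqrt_mul_cos (h.angle_mem t (Ioo_subset_Icc_self htm)) hl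
      (H t ht))

theorem sub_arc_lt (h : ChordSpiral c a b x y φ k) (hψ : 0 ≤ Real.cos ψ)
    (hm : m ≠ 0 ∨ 0 < Real.cos ψ) (ht₁ : t₁ ∈ Icc a b) (ht₂ : t₂ ∈ Icc a b)
    (h₁ : |Real.sin ψ + m * (x t₁ - x₀)| ≤ 1) (h₂ : |Real.sin ψ + m * (x t₂ - x₀)| ≤ 1)
    (hlt : t₁ < t₂) (H : ∀ t ∈ Ioo t₁ t₂, Real.sin ψ + m * (x t - x₀) < Real.sin (φ t)) :
    y t₁ - arcThrough x₀ ψ m (x t₁) < y t₂ - arcThrough x₀ ψ m (x t₂) := by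
  refine strictMonoOn_of_deriv_pos (convex_Icc t₁ t₂)
    (h.continuousOn_sub_arc hψ hm ht₁ ht₂ h₁ h₂) ?_ ⟨le_rfl, hlt.le⟩ ⟨hlt.le, le_rfl⟩ hlt
  rw [interior_Icc]
  intro t ht
  have htm : t ∈ Ioo a b := ⟨ht₁.1.trans_lt ht.1, ht.2.trans_le ht₂.2⟩
  have hl := h.abs_line_lt_one hm ht₁ ht₂ h₁ h₂ ht
  rw [(h.hasDerivAt_sub_arc hψ htm hl).deriv]
  exact sub_pos.2 (div_sqrt_mul_cos_lt_sin (h.angle_mem t (Ioo_subset_Icc_self htm)) hl (H t ht))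

theorem lt_sub_arc (h : ChordSpiral c a b x y φ k) (hψ : 0 ≤ Real.cos ψ)
    (hm : m ≠ 0 ∨ 0 < Real.cos ψ) (ht₁ : t₁ ∈ Icc a b) (ht₂ : t₂ ∈ Icc a b)
    (h₁ : |Real.sin ψ + m * (x t₁ - x₀)| ≤ 1) (h₂ : |Real.sin ψ + m * (x t₂ - x₀)| ≤ 1)
    (hlt : t₁ < t₂) (H : ∀ t ∈ Ioo t₁ t₂, Real.sin (φ t) < Real.sin ψ + m * (x t - x₀)) :
    y t₂ - arcThrough x₀ ψ m (x t₂) < y t₁ - arcThrough x₀ ψ m (x t₁) := by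
  refine strictAntiOn_of_deriv_neg (convex_Icc t₁ t₂)
    (h.continuousOn_sub_arc hψ hm ht₁ ht₂ h₁ h₂) ?_ ⟨le_rfl, hlt.le⟩ ⟨hlt.le, le_rfl⟩ hlt
  rw [interior_Icc]
  intro t ht
  have htm : t ∈ Ioo a b := ⟨ht₁.1.trans_lt ht.1, ht.2.trans_le ht₂.2⟩
  have hl := h.abs_line_lt_one hm ht₁ ht₂ h₁ h₂ ht
  rw [(h.hasDerivAt_sub_arc hψ htm hl).deriv]
  exact sub_neg.2 (sin_lt_div_sqrt_mul_cos (h.angle_mem t (Ioo_subset_Icc_self htm)) hl (H t ht))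

/-- `sin φ` minus an affine function of `x` is quasiconvex. -/
theorem quasiconvex (h : ChordSpiral c a b x y φ k) {t₁ t₂ t : ℝ} (ht₁ : t₁ ∈ Icc a b)
    (ht₂ : t₂ ∈ Icc a b) (h₁ : t₁ ≤ t) (h₂ : t ≤ t₂) :
    Real.sin (φ t) - (Real.sin ψ + m * (x t - x₀)) ≤
        Real.sin (φ t₁) - (Real.sin ψ + m * (x t₁ - x₀)) ∨
      Real.sin (φ t) - (Real.sin ψ + m * (x t - x₀)) ≤
        Real.sin (φ t₂) - (Real.sin ψ + m * (x t₂ - x₀)) := by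
  have htm : t ∈ Icc a b := ⟨ht₁.1.trans h₁, h₂.trans ht₂.2⟩
  -- The support line at `t` has slope `k t`; if this is at most `m`, the difference is no smaller
  -- at the earlier point, otherwise at the later one.
  rcases le_total (k t) m with hk | hk
  · left
    have h3 := h.support t htm t₁ ht₁
    have h4 := h.strictMono.monotoneOn ht₁ htm h₁
    nlinarith
  · right
    have h3 := h.support t htm t₂ ht₂
    have h4 := h.strictMono.monotoneOn htm ht₂ h₂
    nlinarith

/-- If the spiral is above an arc at both ends of an interval and its final direction is
not steeper, it is above the arc on the whole interval. -/
theorem arc_le_of_ends (h : ChordSpiral c a b x y φ k) (hψ : 0 ≤ Real.cos ψ)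
    (hm : m ≠ 0 ∨ 0 < Real.cos ψ) (ht₁ : t₁ ∈ Icc a b) (ht₂ : t₂ ∈ Icc a b)
    (h₁ : |Real.sin ψ + m * (x t₁ - x₀)| ≤ 1) (h₂ : |Real.sin ψ + m * (x t₂ - x₀)| ≤ 1)
    (hs : Real.sin (φ t₂) ≤ Real.sin ψ + m * (x t₂ - x₀))
    (hy₁ : arcThrough x₀ ψ m (x t₁) ≤ y t₁) (hy₂ : arcThrough x₀ ψ m (x t₂) ≤ y t₂)
    {t : ℝ} (ht : t ∈ Icc t₁ t₂) : arcThrough x₀ ψ m (x t) ≤ y t := by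
  have htm : t ∈ Icc a b := ⟨ht₁.1.trans ht.1, ht.2.trans ht₂.2⟩
  have hl : |Real.sin ψ + m * (x t - x₀)| ≤ 1 := by
    rcases eq_or_lt_of_le ht.1 with e | e
    · rw [← e]; exact h₁
    rcases eq_or_lt_of_le ht.2 with e' | e'
    · rw [e']; exact h₂
    exact (h.abs_line_lt_one hm ht₁ ht₂ h₁ h₂ ⟨e, e'⟩).le
  -- If `sin φ` is not above the line at `t`, quasiconvexity keeps it so up to `t₂`, and `y - arc`
  -- decreases from `t` to a nonnegative value. Otherwise `sin φ` is above the line on all of `(t₁,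
  -- t)`, and `y - arc` increases from a nonnegative value.
  rcases le_or_gt (Real.sin (φ t)) (Real.sin ψ + m * (x t - x₀)) with hc | hc
  · have := h.le_sub_arc hψ hm htm ht₂ hl h₂ ht.2 fun u hu => by
      rcases h.quasiconvex (ψ := ψ) (m := m) (x₀ := x₀) htm ht₂ hu.1.le hu.2.le with q | q <;>
        linarith
    linarith
  · have := h.sub_arc_le hψ hm ht₁ htm h₁ hl ht.1 fun u hu => by
      by_contra! hn
      have hum : u ∈ Icc a b := ⟨ht₁.1.trans hu.1.le, hu.2.le.trans htm.2⟩
      rcases h.quasiconvex (ψ := ψ) (m := m) (x₀ := x₀) hum ht₂ hu.2.le ht.2 with q | q <;>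
        linarith
    linarith

/-! ### End curvatures and Vogt's inequality -/

theorem cos_nonneg (h : ChordSpiral c a b x y φ k) {t : ℝ} (ht : t ∈ Icc a b) :
    0 ≤ Real.cos (φ t) := Real.cos_nonneg_of_mem_Icc (h.angle_mem t ht)

theorem chord_slope_ne_zero_or {c : ℝ} (hc : 0 < c) (ψ : ℝ) (hψ : 0 ≤ Real.cos ψ) :
    Real.sin ψ / c ≠ 0 ∨ 0 < Real.cos ψ := by
  rcases hψ.lt_or_eq with h | h
  · exact .inr h
  · left
    have : Real.sin ψ ≠ 0 := fun h0 => by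
      have := Real.sin_sq_add_cos_sq ψ
      rw [h0, ← h] at this; norm_num at this
    positivity

/-- The end curvature is at least that of the circular arc over the chord with the same
end tangent. -/
theorem sin_div_le_curv_right (h : ChordSpiral c a b x y φ k) : Real.sin (φ b) / c ≤ k b := by
  by_contra! hk
  have hc := h.c_pos
  -- The support line at `b` would put `sin φ` strictly above the line of the arc, so `y - arc`
  -- would strictly increase although it vanishes at both ends.
  have h0 := h.sub_arc_lt (x₀ := c) (ψ := φ b) (m := Real.sin (φ b) / c) (h.cos_nonneg h.right_mem)
    (chord_slope_ne_zero_or hc _ (h.cos_nonneg h.right_mem)) h.left_mem h.right_mem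
    (by
      have : Real.sin (φ b) + Real.sin (φ b) / c * (x a - c) = -Real.sin (φ b) := by
        rw [h.x_left]; field_simp; ring
      rw [this, abs_neg]; exact Real.abs_sin_le_one _)
    (by rw [h.x_right]; simpa using Real.abs_sin_le_one _) h.lt
    (fun t ht => by
      have htm := Ioo_subset_Icc_self ht
      have h1 := h.support b h.right_mem t htm
      have h2 := h.strictMono htm h.right_mem ht.2
      rw [h.x_right] at h1 h2
      nlinarith)
  rw [← lensArc_neg_eq_arcThrough_right hc, ← lensArc_neg_eq_arcThrough_right hc, h.x_left,
    h.x_right, h.y_left, h.y_right] at h0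
  simp [lensArc] at h0

theorem curv_left_le (h : ChordSpiral c a b x y φ k) : k a ≤ -(Real.sin (φ a) / c) := by
  have := h.mirror.sin_div_le_curv_right
  simp only [neg_neg] at this
  linarith

/-- Vogt's inequality for projectable spirals. -/
theorem angle_add_nonneg (h : ChordSpiral c a b x y φ k) : 0 ≤ φ a + φ b := by
  by_contra! hneg
  have hc := h.c_pos
  have ha := h.angle_mem a h.left_mem
  have hb := h.angle_mem b h.right_mem
  have hs : Real.sin (φ b) < -Real.sin (φ a) := by
    rw [← Real.sin_neg]
    exact Real.sin_lt_sin_of_lt_of_le_pi_div_two hb.1 (by linarith [ha.1]) (by linarith)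
  set m := -(Real.sin (φ a) / c) with hm
  have hmc : m * c = -Real.sin (φ a) := by rw [hm]; field_simp
  have hend : Real.sin (φ a) + m * (x b - -c) = -Real.sin (φ a) := by
    rw [h.x_right]; linear_combination 2 * hmc
  -- The line of the arc runs from `sin φ(a)` to `-sin φ(a) > sin φ(b)`. A convex function with
  -- these end values stays strictly below it inside, so `y - arc` would strictly decrease between
  -- two zeros.
  have h0 := h.lt_sub_arc (x₀ := -c) (ψ := φ a) (m := m)
    (h.cos_nonneg h.left_mem)
    (by simpa [hm] using chord_slope_ne_zero_or hc _ (h.cos_nonneg h.left_mem))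
    h.left_mem h.right_mem
    (by rw [h.x_left]; simpa using Real.abs_sin_le_one _)
    (by rw [hend, abs_neg]; exact Real.abs_sin_le_one _) h.lt
    (fun t ht => by
      by_contra! hn
      have htm := Ioo_subset_Icc_self ht
      rcases le_or_gt m (k t) with hk | hk
      · have h1 := h.support t htm b h.right_mem
        have h2 := h.strictMono htm h.right_mem ht.2
        nlinarith
      · have h1 := h.support t htm a h.left_mem
        have h2 := h.strictMono h.left_mem htm ht.1
        rw [h.x_left] at h1 h2
        nlinarith)
  rw [hm, ← lensArc_eq_arcThrough_left hc, ← lensArc_eq_arcThrough_left hc, h.x_left,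
    h.x_right, h.y_left, h.y_right] at h0
  simp [lensArc] at h0

end ChordSpiral

/-! ### Short biarcs -/

section Biarc

variable {c α β p : ℝ}

theorem biarc_denom_pos (hp : 0 < p) {d : ℝ} (hd : 0 ≤ d) : 0 < p ^ 2 + 2 * p * d + 1 := by
  positivity

/-- Passing to the half-sum and half-difference of `α`, `β` factors the curvature jump, the
denominator of `biarcJoin`, and shows its sign. -/
theorem biarcEndCurv_sub_biarcStartCurv (hc : 0 < c) (hp : 0 < p) :
    biarcEndCurv c α β p - biarcStartCurv c α β p =
      Real.sin ((α + β) / 2) * (p ^ 2 + 2 * p * Real.cos ((α - β) / 2) + 1) / (p * c) := by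
  have h1 := Real.sin_add ((α + β) / 2) ((α - β) / 2)
  have h2 := Real.sin_sub ((α + β) / 2) ((α - β) / 2)
  rw [show (α + β) / 2 + (α - β) / 2 = α by ring] at h1
  rw [show (α + β) / 2 - (α - β) / 2 = β by ring] at h2
  unfold biarcEndCurv biarcStartCurv
  rw [h1, h2]
  field_simp
  ring

theorem biarcJoin_eq (hc : 0 < c) (hp : 0 < p) (hd : 0 ≤ Real.cos ((α - β) / 2))
    (hw : 0 < Real.sin ((α + β) / 2)) :
    biarcJoin c α β p = c * (p ^ 2 - 1) / (p ^ 2 + 2 * p * Real.cos ((α - β) / 2) + 1) := by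
  have hD := biarc_denom_pos hp hd
  unfold biarcJoin
  rw [biarcEndCurv_sub_biarcStartCurv hc hp]
  have h : Real.sin α - Real.sin β + (biarcStartCurv c α β p + biarcEndCurv c α β p) * c =
      Real.sin ((α + β) / 2) * (p ^ 2 - 1) / p := by
    unfold biarcEndCurv biarcStartCurv
    field_simp
    ring
  rw [h]
  field_simp

/-- At the join of a short biarc, its two arcs have the same ordinate and the same tangent. -/
theorem biarc_join (hc : 0 < c) (hα : 0 ≤ Real.cos α) (hβ : 0 ≤ Real.cos β) (hp : 0 < p)
    (hd : 0 ≤ Real.cos ((α - β) / 2)) (hw : 0 < Real.sin ((α + β) / 2))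
    (hw' : 0 ≤ Real.cos ((α + β) / 2)) :
    -c < biarcJoin c α β p ∧ biarcJoin c α β p < c ∧
    |Real.sin α + biarcStartCurv c α β p * (biarcJoin c α β p - -c)| ≤ 1 ∧
    |Real.sin β + biarcEndCurv c α β p * (biarcJoin c α β p - c)| ≤ 1 ∧
    arcThrough (-c) α (biarcStartCurv c α β p) (biarcJoin c α β p) =
      arcThrough c β (biarcEndCurv c α β p) (biarcJoin c α β p) := by
  have hD := biarc_denom_pos hp hd
  have hX := biarcJoin_eq hc hp hd hw
  have hsα := Real.sin_add ((α + β) / 2) ((α - β) / 2)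
  have hsβ := Real.sin_sub ((α + β) / 2) ((α - β) / 2)
  have hcα := Real.cos_add ((α + β) / 2) ((α - β) / 2)
  have hcβ := Real.cos_sub ((α + β) / 2) ((α - β) / 2)
  rw [show (α + β) / 2 + (α - β) / 2 = α by ring] at hsα hcα
  rw [show (α + β) / 2 - (α - β) / 2 = β by ring] at hsβ hcβ
  have hW := Real.sin_sq_add_cos_sq ((α + β) / 2)
  have hΔ := Real.sin_sq_add_cos_sq ((α - β) / 2)
  unfold arcThrough
  rw [hX]
  unfold biarcStartCurv biarcEndCurv
  generalize Real.sin ((α + β) / 2) = sW at *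
  generalize Real.cos ((α + β) / 2) = cW at *
  generalize Real.sin ((α - β) / 2) = sD at *
  generalize Real.cos ((α - β) / 2) = cD at *
  generalize Real.sin α = sA at *
  generalize Real.cos α = cA at *
  generalize Real.sin β = sB at *
  generalize Real.cos β = cB at *
  clear hX
  set D := p ^ 2 + 2 * p * cD + 1 with hDdef
  set X := c * (p ^ 2 - 1) / D with hX
  -- `l` and `q` are the sine and cosine of the common tangent angle at the join; `hL` and `hR` show
  -- that both arcs reach the same `l`.
  set l := -(p ^ 2 * sA + 2 * p * sW + sB) / D with hl
  set q := (p ^ 2 * cA + 2 * p * cW + cB) / D with hq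
  have hXl : X - -c = 2 * p * c * (p + cD) / D := by rw [hX, hDdef]; field_simp; ring
  have hXr : X - c = -(2 * c * (1 + p * cD) / D) := by rw [hX, hDdef]; field_simp; ring
  have hq0 : 0 ≤ q := by positivity
  have hlq : l ^ 2 + q ^ 2 = 1 := by
    rw [hl, hq, div_pow, div_pow, ← add_div, div_eq_one_iff_eq (by positivity), hDdef, hsα, hsβ,
      hcα, hcβ]
    linear_combination ((p ^ 2 - 1) ^ 2 * (sD ^ 2 + cD ^ 2) + 4 * p ^ 2 + 4 * p * cD * (p ^ 2 + 1)
      + 4 * p ^ 2 * cD ^ 2) * hW + (p ^ 2 - 1) ^ 2 * hΔ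
  have hL : sA + -(sA + sW / p) / c * (X - -c) = l := by
    rw [hXl, hl]
    field_simp
    rw [hDdef, hsα, hsβ]
    ring
  have hR : sB + (sB + p * sW) / c * (X - c) = l := by
    rw [hXr, hl]
    field_simp
    rw [hDdef, hsα, hsβ]
    ring
  have hl1 : |l| ≤ 1 := by rw [← sq_le_one_iff_abs_le_one]; nlinarith
  have hsq : √(1 - l ^ 2) = q := by
    rw [show 1 - l ^ 2 = q ^ 2 by linarith, Real.sqrt_sq hq0]
  refine ⟨?_, ?_, by rwa [hL], by rwa [hR], ?_⟩
  · have : 0 < X - -c := by rw [hXl]; positivity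
    linarith
  · have : X - c < 0 := by rw [hXr]; exact neg_neg_of_pos (by positivity)
    linarith
  rw [hL, hR, hsq]
  have hL2 : 2 * sA + -(sA + sW / p) / c * (X - -c) = sA + l := by linarith
  have hR2 : 2 * sB + (sB + p * sW) / c * (X - c) = sB + l := by linarith
  rw [hL2, hR2, hXl, hXr]
  -- Numerator and denominator of each arc's ordinate share a factor, `cW + p * cA` or `p * cW +
  -- cB`. After cancellation both ordinates equal `2 * p * c * sD / D`.
  have nL : sA + l = 2 * sD * (cW + p * cA) / D := by
    rw [hl, eq_div_iff hD.ne', add_mul, div_mul_cancel₀ _ hD.ne', hDdef, hcα, hsα, hsβ]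
    linear_combination (2 * p * sW) * hΔ
  have dL : cA + q = 2 * (p + cD) * (p * cA + cW) / D := by
    rw [hq, eq_div_iff hD.ne', add_mul, div_mul_cancel₀ _ hD.ne', hDdef, hcβ, hcα]
    ring
  have nR : sB + l = -(2 * p * sD * (p * cW + cB)) / D := by
    rw [hl, eq_div_iff hD.ne', add_mul, div_mul_cancel₀ _ hD.ne', hDdef, hcβ, hsα, hsβ]
    linear_combination (2 * p * sW) * hΔ
  have dR : cB + q = 2 * (p * cW + cB) * (p * cD + 1) / D := by
    rw [hq, eq_div_iff hD.ne', add_mul, div_mul_cancel₀ _ hD.ne', hDdef, hcβ, hcα]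
    ring
  rw [nL, dL, nR, dR]
  have hmain : ∀ u : ℝ, (u = 0 → sD = 0) → ∀ e : ℝ, 0 < e →
      2 * sD * u / (2 * e * u) = sD / e := by
    intro u hu e he
    by_cases h0 : u = 0
    · simp [h0, hu h0]
    · field_simp
  -- The cancelled factor is a sum of nonnegative terms, so it vanishes only when both do; then `sW
  -- * sD = 0`, and the ordinate is zero in either form.
  have hz : cW = 0 → (cA = 0 ∨ cB = 0) → sD = 0 := by
    intro h1 h2
    rcases h2 with h2 | h2
    · have : sW * sD = 0 := by rw [h1, h2] at hcα; linarith
      exact (mul_eq_zero.1 this).resolve_left hw.ne'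
    · have : sW * sD = 0 := by rw [h1, h2] at hcβ; linarith
      exact (mul_eq_zero.1 this).resolve_left hw.ne'
  have e1 : 2 * sD * (cW + p * cA) / (2 * (p + cD) * (p * cA + cW)) = sD / (p + cD) := by
    rw [show p * cA + cW = cW + p * cA by ring]
    refine hmain _ (fun h => ?_) _ (by positivity)
    have h1 : cW = 0 := by linarith [mul_nonneg hp.le hα]
    exact hz h1 (.inl (by rw [h1] at h; simpa [hp.ne'] using h))
  have e2 : 2 * sD * (p * cW + cB) / (2 * (p * cD + 1) * (p * cW + cB)) = sD / (p * cD + 1) := by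
    refine hmain _ (fun h => ?_) _ (by positivity)
    have h1 : cB = 0 := by linarith [mul_nonneg hp.le hw']
    exact hz (by rw [h1] at h; simpa [hp.ne'] using h) (.inr h1)
  have f1 : 2 * p * c * (p + cD) / D * (2 * sD * (cW + p * cA) / D) /
      (2 * (p + cD) * (p * cA + cW) / D) =
      2 * p * c * (p + cD) / D * (2 * sD * (cW + p * cA) / (2 * (p + cD) * (p * cA + cW))) := by
    rw [mul_div_assoc, div_div_div_cancel_right₀ hD.ne']
  have f2 : -(2 * c * (1 + p * cD) / D) * (-(2 * p * sD * (p * cW + cB)) / D) /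
      (2 * (p * cW + cB) * (p * cD + 1) / D) =
      2 * p * c * (1 + p * cD) / D *
        (2 * sD * (p * cW + cB) / (2 * (p * cD + 1) * (p * cW + cB))) := by
    rw [mul_div_assoc, div_div_div_cancel_right₀ hD.ne',
      show 2 * (p * cW + cB) * (p * cD + 1) = 2 * (p * cD + 1) * (p * cW + cB) by ring]
    ring
  rw [f1, f2, e1, e2]
  have : 0 < p + cD := by positivity
  have : 0 < p * cD + 1 := by positivity
  field_simp
  ring

theorem biarcEndCurv_eq_neg_biarcStartCurv_swap (c α β p : ℝ) :
    biarcEndCurv c α β p = -biarcStartCurv c β α p⁻¹ := by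
  unfold biarcEndCurv biarcStartCurv
  rw [div_inv_eq_mul, add_comm β α]
  ring

theorem biarcStartCurv_eq_neg_biarcEndCurv_swap (c α β p : ℝ) :
    biarcStartCurv c α β p = -biarcEndCurv c β α p⁻¹ := by
  rw [biarcEndCurv_eq_neg_biarcStartCurv_swap, inv_inv, neg_neg]

theorem biarcJoin_eq_neg_swap (c α β p : ℝ) : biarcJoin c α β p = -biarcJoin c β α p⁻¹ := by
  unfold biarcJoin
  rw [biarcEndCurv_eq_neg_biarcStartCurv_swap c α β, biarcStartCurv_eq_neg_biarcEndCurv_swap c α β,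
    ← neg_div]
  congr 1 <;> ring

end Biarc

/-! ### Comparing a spiral with a short biarc -/

namespace ChordSpiral

variable {c a b α β p : ℝ} {x y φ k : ℝ → ℝ}

/-- Since `α > -β ≥ -π/2`, the only possible vertical start tangent points upwards. The biarc's
first arc then has nonzero curvature, which excludes the degenerate vertical line. -/
theorem sin_eq_one_or_cos_pos (hα : α ∈ Icc (-(Real.pi / 2)) (Real.pi / 2))
    (hβ : β ≤ Real.pi / 2) (hω : 0 < α + β) : Real.sin α = 1 ∨ 0 < Real.cos α := by
  rcases hα.2.lt_or_eq with h | h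
  · exact .inr (Real.cos_pos_of_mem_Ioo ⟨by linarith, h⟩)
  · left; rw [h, Real.sin_pi_div_two]

/-- A single arc with a steeper final direction is below the spiral. -/
theorem lensArc_le (h : ChordSpiral c a b x y φ k)
    (hβ : β ∈ Icc (-(Real.pi / 2)) (Real.pi / 2)) (hb : φ b ≤ β) {t : ℝ} (ht : t ∈ Icc a b) :
    lensArc c (-β) (x t) ≤ y t := by
  have hc := h.c_pos
  have hcos := Real.cos_nonneg_of_mem_Icc hβ
  have e := lensArc_neg_eq_arcThrough_right hc β
  rw [e]
  refine h.arc_le_of_ends hcos (chord_slope_ne_zero_or hc β hcos) h.left_mem h.right_mem ?_ ?_ ?_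
    ?_ ?_ ht
  · have : Real.sin β + Real.sin β / c * (x a - c) = -Real.sin β := by
      rw [h.x_left]; field_simp; ring
    rw [this, abs_neg]; exact Real.abs_sin_le_one _
  · rw [h.x_right]; simpa using Real.abs_sin_le_one _
  · rw [h.x_right]
    simpa using Real.sin_le_sin_of_le_of_le_pi_div_two (h.angle_mem b h.right_mem).1 hβ.2 hb
  · rw [← e, h.x_left, h.y_left]; simp [lensArc]
  · rw [← e, h.x_right, h.y_right]; simp [lensArc]

/-- A single arc with a lower initial direction and a smaller curvature is below the spiral. -/
theorem lensArc_le_of_curv (h : ChordSpiral c a b x y φ k)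
    (hα : α ∈ Icc (-(Real.pi / 2)) (Real.pi / 2)) (ha : α ≤ φ a)
    (hk : -(Real.sin α / c) ≤ k a) {t : ℝ} (ht : t ∈ Icc a b) : lensArc c α (x t) ≤ y t := by
  have hc := h.c_pos
  have hcos := Real.cos_nonneg_of_mem_Icc hα
  have e := lensArc_eq_arcThrough_left hc α
  have hm : -(Real.sin α / c) ≠ 0 ∨ 0 < Real.cos α := by
    simpa using chord_slope_ne_zero_or hc α hcos
  have h₁ : |Real.sin α + -(Real.sin α / c) * (x a - -c)| ≤ 1 := by
    rw [h.x_left]; simpa using Real.abs_sin_le_one _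
  have h₂ : |Real.sin α + -(Real.sin α / c) * (x b - -c)| ≤ 1 := by
    have : Real.sin α + -(Real.sin α / c) * (x b - -c) = -Real.sin α := by
      rw [h.x_right]; field_simp; ring
    rw [this, abs_neg]; exact Real.abs_sin_le_one _
  have hl : |Real.sin α + -(Real.sin α / c) * (x t - -c)| ≤ 1 := by
    rcases eq_or_lt_of_le ht.1 with e | e
    · rw [← e]; exact h₁
    rcases eq_or_lt_of_le ht.2 with e' | e'
    · rw [e']; exact h₂
    exact (h.abs_line_lt_one hm h.left_mem h.right_mem h₁ h₂ ⟨e, e'⟩).le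
  have hs := Real.sin_le_sin_of_le_of_le_pi_div_two hα.1 (h.angle_mem a h.left_mem).2 ha
  have := h.sub_arc_le hcos hm h.left_mem ht h₁ hl ht.1 fun u hu => by
    have hum : u ∈ Icc a b := ⟨hu.1.le, hu.2.le.trans ht.2⟩
    have h3 := h.support a h.left_mem u hum
    have h4 := h.strictMono h.left_mem hum hu.1
    rw [h.x_left] at h3 h4
    nlinarith
  rw [← e, ← e, h.x_left, h.y_left] at this
  simp only [lensArc, even_two, Even.neg_pow, sub_self, zero_mul, zero_div] at this ⊢
  linarith

/-- A short biarc with a lower initial direction, a smaller initial curvature and a steeper final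
direction is below the spiral. -/
theorem biarc_le (h : ChordSpiral c a b x y φ k)
    (hα : α ∈ Icc (-(Real.pi / 2)) (Real.pi / 2)) (hβ : β ∈ Icc (-(Real.pi / 2)) (Real.pi / 2))
    (hω : 0 < α + β) (hp : 0 < p) (ha : α ≤ φ a) (hb : φ b ≤ β)
    (hk : biarcStartCurv c α β p ≤ k a) {t : ℝ} (ht : t ∈ Icc a b) :
    (x t ≤ biarcJoin c α β p → arcThrough (-c) α (biarcStartCurv c α β p) (x t) ≤ y t) ∧
    (biarcJoin c α β p ≤ x t → arcThrough c β (biarcEndCurv c α β p) (x t) ≤ y t) := by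
  have hc := h.c_pos
  have hcα := Real.cos_nonneg_of_mem_Icc hα
  have hcβ := Real.cos_nonneg_of_mem_Icc hβ
  have hw : 0 < Real.sin ((α + β) / 2) :=
    Real.sin_pos_of_pos_of_lt_pi (by linarith) (by linarith [hα.2, hβ.2, Real.pi_pos])
  obtain ⟨hX1, hX2, hl1, hl2, hjoin⟩ := biarc_join hc hcα hcβ hp
    (Real.cos_nonneg_of_mem_Icc ⟨by linarith [hα.1, hβ.2], by linarith [hα.2, hβ.1]⟩) hw
    (Real.cos_nonneg_of_mem_Icc ⟨by linarith [hα.1, hβ.1], by linarith [hα.2, hβ.2]⟩)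
  have hmα : biarcStartCurv c α β p ≠ 0 ∨ 0 < Real.cos α := by
    refine (sin_eq_one_or_cos_pos hα hβ.2 hω).imp_left fun h1 => ?_
    unfold biarcStartCurv
    rw [h1]
    have : 0 < 1 + Real.sin ((α + β) / 2) / p := by positivity
    exact div_ne_zero (neg_ne_zero.2 this.ne') hc.ne'
  have hmβ : biarcEndCurv c α β p ≠ 0 ∨ 0 < Real.cos β := by
    refine (sin_eq_one_or_cos_pos hβ hα.2 (by linarith)).imp_left fun h1 => ?_
    unfold biarcEndCurv
    rw [h1]
    positivity
  set A := biarcStartCurv c α β p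
  set B := biarcEndCurv c α β p
  set X := biarcJoin c α β p
  have hxc : ContinuousOn x (Icc a b) := fun t ht => (h.x_deriv t ht).continuousWithinAt
  obtain ⟨r, hr, hxr⟩ : ∃ r ∈ Icc a b, x r = X := by
    have := intermediate_value_Icc h.lt.le hxc
    rw [h.x_left, h.x_right] at this
    exact this ⟨hX1.le, hX2.le⟩
  rw [← hxr] at hl1 hl2 hjoin ⊢
  have hl0 : |Real.sin α + A * (x a - -c)| ≤ 1 := by
    rw [h.x_left]; simpa using Real.abs_sin_le_one _
  have hs := Real.sin_le_sin_of_le_of_le_pi_div_two hα.1 (h.angle_mem a h.left_mem).2 ha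
  have hstart : ∀ t ∈ Icc a r, arcThrough (-c) α A (x t) ≤ y t := by
    intro t htr
    have ht : t ∈ Icc a b := ⟨htr.1, htr.2.trans hr.2⟩
    have hl : |Real.sin α + A * (x t - -c)| ≤ 1 := by
      rcases eq_or_lt_of_le htr.1 with e | e
      · rw [← e]; exact hl0
      rcases eq_or_lt_of_le htr.2 with e' | e'
      · rw [e']; exact hl1
      exact (h.abs_line_lt_one hmα h.left_mem hr hl0 hl1 ⟨e, e'⟩).le
    have := h.sub_arc_le hcα hmα h.left_mem ht hl0 hl ht.1 fun u hu => by
      have hum : u ∈ Icc a b := ⟨hu.1.le, hu.2.le.trans ht.2⟩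
      have h3 := h.support a h.left_mem u hum
      have h4 := h.strictMono h.left_mem hum hu.1
      rw [h.x_left] at h3 h4
      nlinarith
    rw [h.x_left, h.y_left, arcThrough_self] at this
    linarith
  -- Both claims include the join itself, since the mirror image of the biarc assigns the join to
  -- the other arc.
  refine ⟨fun hx => hstart t ⟨ht.1, (h.strictMono.le_iff_le ht hr).1 hx⟩, fun hx => ?_⟩
  refine h.arc_le_of_ends hcβ hmβ hr h.right_mem hl2 ?_ ?_ ?_ ?_
    ⟨(h.strictMono.le_iff_le hr ht).1 hx, ht.2⟩
  · rw [h.x_right]; simpa using Real.abs_sin_le_one _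
  · rw [h.x_right]
    simpa using Real.sin_le_sin_of_le_of_le_pi_div_two (h.angle_mem b h.right_mem).1 hβ.2 hb
  · rw [← hjoin]; exact hstart r ⟨hr.1, le_rfl⟩
  · rw [h.x_right, h.y_right, arcThrough_self]

theorem shortBiarc_le (h : ChordSpiral c a b x y φ k)
    (hα : α ∈ Icc (-(Real.pi / 2)) (Real.pi / 2)) (hβ : β ∈ Icc (-(Real.pi / 2)) (Real.pi / 2))
    (hω : 0 ≤ α + β) (ha : α ≤ φ a) (hb : φ b ≤ β) {p : ENNReal}
    (htop : α + β ≠ 0 → p = ⊤ → -(Real.sin α / c) ≤ k a)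
    (hk : α + β ≠ 0 → p ≠ 0 → p ≠ ⊤ → biarcStartCurv c α β p.toReal ≤ k a)
    {t : ℝ} (ht : t ∈ Icc a b) : shortBiarc c α β p (x t) ≤ y t := by
  unfold shortBiarc
  by_cases h0 : α + β = 0
  · rw [if_pos (.inl h0), show α = -β by linarith]
    exact h.lensArc_le hβ hb ht
  by_cases h1 : p = ⊤
  · rw [if_pos (.inr h1)]
    exact h.lensArc_le_of_curv hα ha (htop h0 h1) ht
  rw [if_neg (by tauto)]
  by_cases h2 : p = 0
  · rw [if_pos h2]
    exact h.lensArc_le hβ hb ht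
  rw [if_neg h2]
  have := h.biarc_le hα hβ (lt_of_le_of_ne hω (Ne.symm h0)) (ENNReal.toReal_pos h2 h1) ha hb
    (hk h0 h2 h1) ht
  split_ifs with hx
  · exact this.1 hx
  · exact this.2 (not_le.1 hx).le

/-- Apply the lower bound to the mirrored spiral: the half-turn with reversal exchanges `α` with
`β`, `p` with `p⁻¹`, and the start curvature with minus the end curvature. -/
theorem le_shortBiarc (h : ChordSpiral c a b x y φ k)
    (hα : α ∈ Icc (-(Real.pi / 2)) (Real.pi / 2)) (hβ : β ∈ Icc (-(Real.pi / 2)) (Real.pi / 2))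
    (hω : 0 ≤ α + β) (ha : φ a ≤ α) (hb : β ≤ φ b) {p : ENNReal}
    (hzero : α + β ≠ 0 → p = 0 → k b ≤ Real.sin β / c)
    (hk : α + β ≠ 0 → p ≠ 0 → p ≠ ⊤ → k b ≤ biarcEndCurv c α β p.toReal)
    {t : ℝ} (ht : t ∈ Icc a b) : y t ≤ shortBiarc c α β p (x t) := by
  have hm := h.mirror
  have htm : -t ∈ Icc (-b) (-a) := ⟨neg_le_neg ht.2, neg_le_neg ht.1⟩
  have hlens : ∀ ψ z, lensArc c (-ψ) (-z) = -lensArc c ψ z := fun ψ z => by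
    simp [lensArc, neg_div]
  have hA : y t ≤ lensArc c α (x t) := by
    have := hm.lensArc_le hα (by simpa using ha) htm
    simp only [neg_neg, hlens] at this
    linarith
  unfold shortBiarc
  by_cases h0 : α + β = 0
  · rw [if_pos (.inl h0)]; exact hA
  by_cases h1 : p = ⊤
  · rw [if_pos (.inr h1)]; exact hA
  rw [if_neg (by tauto)]
  by_cases h2 : p = 0
  · rw [if_pos h2]
    have := hm.lensArc_le_of_curv hβ (by simpa using hb)
      (by simpa using hzero h0 h2) htm
    rw [← neg_neg (lensArc c (-β) (x t)), ← hlens]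
    simp only [neg_neg] at this ⊢
    linarith
  rw [if_neg h2]
  have hp := ENNReal.toReal_pos h2 h1
  have := hm.biarc_le hβ hα (lt_of_le_of_ne (by linarith) (by rw [add_comm]; exact Ne.symm h0))
    (inv_pos.2 hp) (by simpa using hb) (by simpa using ha)
    (by
      have := hk h0 h2 h1
      rw [biarcEndCurv_eq_neg_biarcStartCurv_swap] at this
      simpa using le_neg.1 this) htm
  rw [biarcJoin_eq_neg_swap, biarcStartCurv_eq_neg_biarcEndCurv_swap c α,
    biarcEndCurv_eq_neg_biarcStartCurv_swap c α]
  simp only [neg_neg] at this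
  split_ifs with hx
  · have h3 := this.2 (by linarith)
    have h4 := arcThrough_neg c α (biarcEndCurv c β α p.toReal⁻¹) (-x t)
    rw [neg_neg] at h4
    rw [h4]; linarith
  · have h3 := this.1 (by linarith)
    have h4 := arcThrough_neg (-c) β (biarcStartCurv c β α p.toReal⁻¹) (-x t)
    rw [neg_neg, neg_neg] at h4
    rw [h4]; linarith

end ChordSpiral

/-! ### Spirals in the coordinates of a chord -/

/-- The function `sin φ - k(t₀) x` has derivative `(k - k(t₀)) cos φ` at the continuity points of
`k`. A monotone `k` has only countably many discontinuities, so the fundamental theorem of calculus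
still applies, and the integral from `t₀` to `t` is nonnegative in either direction. -/
theorem sin_support_of_monotoneOn {a b : ℝ} {x φ k : ℝ → ℝ} (hk : MonotoneOn k (Icc a b))
    (hφ : ∀ t ∈ Icc a b, φ t = φ a + ∫ u in a..t, k u)
    (hx : ∀ t ∈ Icc a b, HasDerivWithinAt x (Real.cos (φ t)) (Icc a b) t)
    (hcos : ∀ t ∈ Icc a b, 0 ≤ Real.cos (φ t)) :
    ∀ t₀ ∈ Icc a b, ∀ t ∈ Icc a b,
      Real.sin (φ t₀) + k t₀ * (x t - x t₀) ≤ Real.sin (φ t) := by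
  intro t₀ ht₀ t ht
  have hab : a ≤ b := ht.1.trans ht.2
  have hki : IntervalIntegrable k MeasureTheory.volume a b :=
    MonotoneOn.intervalIntegrable (by rwa [uIcc_of_le hab])
  have hφc : ContinuousOn φ (Icc a b) := by
    have h1 := intervalIntegral.continuousOn_primitive_interval
      (μ := MeasureTheory.volume) (f := k) (a := a) (b := b)
      ((intervalIntegrable_iff' ).1 hki)
    rw [uIcc_of_le hab] at h1
    exact (continuousOn_const.add h1).congr hφ
  have hxc : ContinuousOn x (Icc a b) := fun t ht => (hx t ht).continuousWithinAt
  have hsub : uIcc t₀ t ⊆ Icc a b := uIcc_subset_Icc ht₀ ht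
  have hderiv : ∀ u ∈ Ioo a b \ {u | u ∈ Icc a b ∧ ¬ContinuousWithinAt k (Icc a b) u},
      HasDerivAt (fun u => Real.sin (φ u) - k t₀ * x u) ((k u - k t₀) * Real.cos (φ u)) u := by
    rintro u ⟨hu, hu'⟩
    have hum := Ioo_subset_Icc_self hu
    have hn := Icc_mem_nhds hu.1 hu.2
    have hkc : ContinuousAt k u := by
      have : ContinuousWithinAt k (Icc a b) u := by
        by_contra hcon
        exact hu' ⟨hum, hcon⟩
      exact this.continuousAt hn
    have h1 : HasDerivAt (fun t => ∫ v in a..t, k v) (k u) u :=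
      intervalIntegral.integral_hasDerivAt_right
        (hki.mono_set (by rw [uIcc_of_le hab, uIcc_of_le hum.1]; exact Icc_subset_Icc_right hum.2))
        ⟨Icc a b, hn, ((intervalIntegrable_iff_integrableOn_Icc_of_le hab).1
          hki).aestronglyMeasurable⟩ hkc
    have h2 : HasDerivAt φ (k u) u := by
      refine (h1.const_add (φ a)).congr_of_eventuallyEq ?_
      filter_upwards [hn] with v hv using hφ v hv
    refine (h2.sin.sub (((hx u hum).hasDerivAt hn).const_mul (k t₀))).congr_deriv ?_
    ring
  have hint : IntervalIntegrable (fun u => (k u - k t₀) * Real.cos (φ u))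
      MeasureTheory.volume t₀ t := by
    refine IntervalIntegrable.mul_continuousOn ?_ ((Real.continuous_cos.comp_continuousOn hφc).mono
      hsub)
    exact (hki.mono_set (by rwa [uIcc_of_le hab])).sub intervalIntegrable_const
  have key := MeasureTheory.integral_eq_of_hasDerivAt_off_countable
    (fun u => Real.sin (φ u) - k t₀ * x u) (fun u => (k u - k t₀) * Real.cos (φ u))
    hk.countable_not_continuousWithinAt
    (((Real.continuous_sin.comp_continuousOn hφc).sub (continuousOn_const.mul hxc)).mono hsub)
    (fun u hu => hderiv u ⟨⟨(le_min ht₀.1 ht.1).trans_lt hu.1.1, hu.1.2.trans_le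
      (max_le ht₀.2 ht.2)⟩, hu.2⟩) hint
  have hpos : 0 ≤ ∫ u in t₀..t, (k u - k t₀) * Real.cos (φ u) := by
    rcases le_total t₀ t with h | h
    · refine intervalIntegral.integral_nonneg h fun u hu => ?_
      have hum : u ∈ Icc a b := ⟨ht₀.1.trans hu.1, hu.2.trans ht.2⟩
      exact mul_nonneg (sub_nonneg.2 (hk ht₀ hum hu.1)) (hcos u hum)
    · rw [intervalIntegral.integral_symm, ← intervalIntegral.integral_neg]
      refine intervalIntegral.integral_nonneg h fun u hu => ?_
      have hum : u ∈ Icc a b := ⟨ht.1.trans hu.1, hu.2.trans ht₀.2⟩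
      rw [← neg_mul]
      exact mul_nonneg (by linarith [hk hum ht₀ hu.2]) (hcos u hum)
  rw [key] at hpos
  linarith

/-- A curve with nondecreasing curvature whose projection onto its chord is injective. -/
theorem ChordSpiral.of_injOn {c a b : ℝ} {x y φ k : ℝ → ℝ} (hab : a < b) (hc : 0 < c)
    (hx : ∀ t ∈ Icc a b, HasDerivWithinAt x (Real.cos (φ t)) (Icc a b) t)
    (hy : ∀ t ∈ Icc a b, HasDerivWithinAt y (Real.sin (φ t)) (Icc a b) t)
    (hk : MonotoneOn k (Icc a b)) (hφ : ∀ t ∈ Icc a b, φ t = φ a + ∫ u in a..t, k u)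
    (hinj : InjOn x (Icc a b)) (ha : φ a ∈ Ioc (-Real.pi) Real.pi)
    (xa : x a = -c) (xb : x b = c) (ya : y a = 0) (yb : y b = 0) :
    ChordSpiral c a b x y φ k := by
  have hxc : ContinuousOn x (Icc a b) := fun t ht => (hx t ht).continuousWithinAt
  -- A continuous injective projection running from `-c` to `c` increases, hence `cos φ ≥ 0`.
  have hmono := hxc.strictMonoOn_of_injOn_Icc hab.le (by rw [xa, xb]; linarith) hinj
  have hcos : ∀ t ∈ Icc a b, 0 ≤ Real.cos (φ t) := fun t ht => by
    rw [← (hx t ht).derivWithin (uniqueDiffOn_Icc hab t ht)]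
    exact hmono.monotoneOn.derivWithin_nonneg
  have hki : IntervalIntegrable k MeasureTheory.volume a b :=
    MonotoneOn.intervalIntegrable (by rwa [uIcc_of_le hab.le])
  have hφc : ContinuousOn φ (Icc a b) := by
    have h1 := intervalIntegral.continuousOn_primitive_interval
      (μ := MeasureTheory.volume) (f := k) (a := a) (b := b)
      ((intervalIntegrable_iff' ).1 hki)
    rw [uIcc_of_le hab.le] at h1
    exact (continuousOn_const.add h1).congr hφ
  have hpi := Real.pi_pos
  have ham : a ∈ Icc a b := ⟨le_rfl, hab.le⟩
  have ha' : φ a ∈ Icc (-(Real.pi / 2)) (Real.pi / 2) := by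
    have h0 := hcos a ham
    constructor
    · by_contra! h
      have := Real.cos_neg_of_pi_div_two_lt_of_lt (x := -φ a) (by linarith) (by linarith [ha.1])
      rw [Real.cos_neg] at this
      linarith
    · by_contra! h
      have := Real.cos_neg_of_pi_div_two_lt_of_lt (x := φ a) h (by linarith [ha.2])
      linarith
  refine ⟨hab, hx, hy, hmono, fun t ht => ⟨?_, ?_⟩, hk, sin_support_of_monotoneOn hk hφ hx hcos,
    xa, xb, ya, yb⟩
  -- If `φ` left `[-π/2, π/2]`, by continuity it would take a value just outside, within distance
  -- `π` of zero, where the cosine can only be negative; the truncation at `-π` finds one.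
  · by_contra! h
    obtain ⟨u, hu, hue⟩ := intermediate_value_Icc' ht.1 (hφc.mono (Icc_subset_Icc_right ht.2))
      (⟨le_max_left (φ t) (-Real.pi), max_le (by linarith [ha'.1]) (by linarith [ha'.1])⟩ :
        max (φ t) (-Real.pi) ∈ Icc (φ t) (φ a))
    have h1 := hcos u ⟨hu.1, hu.2.trans ht.2⟩
    have := Real.cos_neg_of_pi_div_two_lt_of_lt (x := -φ u)
      (by rw [hue, lt_neg]; exact max_lt (by linarith) (by linarith))
      (by rw [hue]; linarith [le_max_right (φ t) (-Real.pi)])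
    rw [Real.cos_neg] at this
    linarith
  · by_contra! h
    obtain ⟨u, hu, hue⟩ := intermediate_value_Icc ht.1 (hφc.mono (Icc_subset_Icc_right ht.2))
      (⟨le_min (by linarith [ha'.2]) (by linarith [ha'.2]), min_le_left (φ t) Real.pi⟩ :
        min (φ t) Real.pi ∈ Icc (φ a) (φ t))
    have h1 := hcos u ⟨hu.1, hu.2.trans ht.2⟩
    have := Real.cos_neg_of_pi_div_two_lt_of_lt (x := φ u)
      (by rw [hue]; exact lt_min (by linarith) (by linarith))
      (by rw [hue]; linarith [min_le_right (φ t) Real.pi])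
    linarith

/-- A number of `[-π, π]` congruent to `r ∈ (-π, π)` modulo `2π` is equal to `r`. -/
theorem eq_of_coe_angle_eq {r z : ℝ} (h1 : -Real.pi < r) (h2 : r < Real.pi)
    (hz : z ∈ Icc (-Real.pi) Real.pi) (h : (z : Real.Angle) = r) : z = r := by
  have hr := Real.Angle.toReal_coe_eq_self_iff.2 ⟨h1, h2.le⟩
  rcases hz.1.lt_or_eq with hlt | heq
  · rw [← hr, ← h]
    exact (Real.Angle.toReal_coe_eq_self_iff.2 ⟨hlt, hz.2⟩).symm
  · rw [← h, ← heq, Real.Angle.coe_neg, Real.Angle.neg_coe_pi, Real.Angle.toReal_pi] at hr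
    linarith

theorem arg_mk_cos_sin {r : ℝ} (hr : r ∈ Ioc (-Real.pi) Real.pi) :
    Complex.arg ⟨Real.cos r, Real.sin r⟩ = r := by
  have e : (⟨Real.cos r, Real.sin r⟩ : ℂ) = Complex.cos r + Complex.sin r * Complex.I := by
    rw [← Complex.exp_mul_I]
    exact Complex.ext (Complex.exp_ofReal_mul_I_re r).symm (Complex.exp_ofReal_mul_I_im r).symm
  rw [e, Complex.arg_cos_add_sin_mul_I hr]

/-! ### Segments of an interpolating spiral -/

namespace SplineData

variable {D : SplineData} {s : ℕ → ℝ} {γ : ℝ → ℂ} {θ k : ℝ → ℝ} {j : ℕ}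

theorem c_pos (hD : D.Admissible) (h1 : 1 ≤ j) (h2 : j ≤ D.M) : 0 < D.c j := by
  rw [c, if_pos ⟨h1, h2⟩]
  have := norm_pos_iff.2 (sub_ne_zero.2 (hD.ne_succ j h1 h2).symm)
  positivity

theorem c_nonneg (j : ℕ) : 0 ≤ D.c j := by
  unfold c; split_ifs <;> positivity

theorem chord_eq (h1 : 1 ≤ j) (h2 : j ≤ D.M) :
    D.P (j + 1) - D.P j = 2 * D.c j * Complex.exp (D.mu j * Complex.I) := by
  rw [c, if_pos ⟨h1, h2⟩, mu, if_neg (by omega), if_neg (by omega)]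
  push_cast
  rw [mul_div_cancel₀ _ two_ne_zero, Complex.norm_mul_exp_arg_mul_I]

theorem rho_coe (j : ℕ) : (D.rho j : Real.Angle) = ((D.mu j - D.mu (j - 1) : ℝ) : Real.Angle) :=
  Real.Angle.coe_toReal _

theorem alpha_coe (j : ℕ) : (D.alpha s θ j : Real.Angle) = ((θ (s j) - D.mu j : ℝ) : Real.Angle) :=
  Real.Angle.coe_toReal _

theorem toLocal_left (h1 : 1 ≤ j) (h2 : j ≤ D.M) : D.toLocal j (D.P j) = ((-D.c j : ℝ) : ℂ) := by
  have h := chord_eq h1 h2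
  have e : D.P j - (D.P j + D.P (j + 1)) / 2 = -(D.P (j + 1) - D.P j) / 2 := by ring
  have e2 : Complex.exp (D.mu j * Complex.I) * Complex.exp (-(D.mu j : ℂ) * Complex.I) = 1 := by
    rw [← Complex.exp_add]; simp
  rw [toLocal, e, h]
  push_cast
  linear_combination (-(D.c j : ℂ)) * e2

theorem toLocal_right (h1 : 1 ≤ j) (h2 : j ≤ D.M) :
    D.toLocal j (D.P (j + 1)) = ((D.c j : ℝ) : ℂ) := by
  have h := chord_eq h1 h2
  have e : D.P (j + 1) - (D.P j + D.P (j + 1)) / 2 = (D.P (j + 1) - D.P j) / 2 := by ring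
  have e2 : Complex.exp (D.mu j * Complex.I) * Complex.exp (-(D.mu j : ℂ) * Complex.I) = 1 := by
    rw [← Complex.exp_add]; simp
  rw [toLocal, e, h]
  linear_combination (D.c j : ℂ) * e2

theorem Interpolates.node_le (hint : D.Interpolates s γ θ) {i : ℕ} (h1 : 1 ≤ i) (hij : i ≤ j)
    (h2 : j ≤ D.M + 1) : s i ≤ s j := by
  induction j, hij using Nat.le_induction with
  | base => exact le_rfl
  | succ j hij ih =>
    exact (ih (by omega)).trans (hint.node_lt j (by omega) (by omega)).le

theorem Interpolates.segment_subset (hint : D.Interpolates s γ θ) (h1 : 1 ≤ j) (h2 : j ≤ D.M) :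
    Icc (s j) (s (j + 1)) ⊆ Icc (s 1) (s (D.M + 1)) :=
  Icc_subset_Icc (hint.node_le le_rfl h1 (by omega)) (hint.node_le (by omega) (by omega) le_rfl)

theorem toLocal_hasDerivWithinAt {S : Set ℝ} {t : ℝ}
    (h : HasDerivWithinAt γ (Complex.exp ((θ t : ℂ) * Complex.I)) S t) :
    HasDerivWithinAt (fun t => D.toLocal j (γ t))
      (Complex.exp (((θ t - D.mu j : ℝ) : ℂ) * Complex.I)) S t := by
  have := (h.sub_const ((D.P j + D.P (j + 1)) / 2)).mul_const
    (Complex.exp (-(D.mu j : ℂ) * Complex.I))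
  rw [← Complex.exp_add] at this
  refine this.congr_deriv ?_
  push_cast
  ring_nf

/-- Each segment of an interpolating spiral, in the coordinates of its chord. -/
theorem Interpolates.chordSpiral (hD : D.Admissible)
    (hspiral : IsSpiral γ θ k (s 1) (s (D.M + 1))) (hint : D.Interpolates s γ θ)
    (h1 : 1 ≤ j) (h2 : j ≤ D.M) :
    ChordSpiral (D.c j) (s j) (s (j + 1)) (fun t => (D.toLocal j (γ t)).re)
      (fun t => (D.toLocal j (γ t)).im) (fun t => θ t - θ (s j) + D.alpha s θ j) k := by
  have hlt := hint.node_lt j h1 h2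
  have hsub := hint.segment_subset h1 h2
  obtain ⟨n, hn⟩ := Real.Angle.angle_eq_iff_two_pi_dvd_sub.1 (alpha_coe (D := D) (s := s) (θ := θ) j)
  -- The continuous angle of the segment differs from `θ - μ_j` by a fixed multiple of `2π`, chosen
  -- so that it starts at the principal value `α_j`.
  have hφ : ∀ t, θ t - θ (s j) + D.alpha s θ j = θ t - D.mu j + n * (2 * Real.pi) := fun t => by
    linear_combination hn
  have hd : ∀ t ∈ Icc (s j) (s (j + 1)), HasDerivWithinAt (fun t => D.toLocal j (γ t))
      (Complex.exp (((θ t - D.mu j : ℝ) : ℂ) * Complex.I)) (Icc (s j) (s (j + 1))) t :=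
    fun t ht => toLocal_hasDerivWithinAt ((hspiral.hasDeriv t (hsub ht)).mono hsub)
  have hki : ∀ t ∈ Icc (s 1) (s (D.M + 1)), IntervalIntegrable k MeasureTheory.volume (s 1) t :=
    fun t ht => MonotoneOn.intervalIntegrable
      (hspiral.monotone.mono (by rw [uIcc_of_le ht.1]; exact Icc_subset_Icc_right ht.2))
  have hl : s j ∈ Icc (s j) (s (j + 1)) := ⟨le_rfl, hlt.le⟩
  have hel := hint.node_eq j h1 (by omega)
  have her := hint.node_eq (j + 1) (by omega) (by omega)
  refine ChordSpiral.of_injOn hlt (c_pos hD h1 h2) (fun t ht => ?_) (fun t ht => ?_)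
    (hspiral.monotone.mono hsub) (fun t ht => ?_) (hint.projectable j h1 h2) ?_ ?_ ?_ ?_ ?_
  · have := Complex.reCLM.hasFDerivAt.comp_hasDerivWithinAt t (hd t ht)
    rw [hφ, Real.cos_add_int_mul_two_pi]
    refine this.congr_deriv ?_
    rw [Complex.reCLM_apply, Complex.exp_ofReal_mul_I_re]
  · have := Complex.imCLM.hasFDerivAt.comp_hasDerivWithinAt t (hd t ht)
    rw [hφ, Real.sin_add_int_mul_two_pi]
    refine this.congr_deriv ?_
    rw [Complex.imCLM_apply, Complex.exp_ofReal_mul_I_im]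
  · have e1 := hspiral.turning t (hsub ht)
    have e2 := hspiral.turning (s j) (hsub hl)
    have e3 := intervalIntegral.integral_interval_sub_left (hki t (hsub ht)) (hki _ (hsub hl))
    linarith
  · simp only [sub_self, zero_add]
    exact ⟨Real.Angle.neg_pi_lt_toReal _, Real.Angle.toReal_le_pi _⟩
  all_goals simp only [hel, her, toLocal_left h1 h2, toLocal_right h1 h2, Complex.ofReal_re,
    Complex.ofReal_im]

/-- The continuous angle remains in `[-π/2, π/2]` along the segment, so its final value is already
the principal one. -/
theorem Interpolates.angle_right_eq_beta (hD : D.Admissible)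
    (hspiral : IsSpiral γ θ k (s 1) (s (D.M + 1))) (hint : D.Interpolates s γ θ)
    (h1 : 1 ≤ j) (h2 : j ≤ D.M) :
    θ (s (j + 1)) - θ (s j) + D.alpha s θ j = D.beta s θ j := by
  have h := hint.chordSpiral hD hspiral h1 h2
  have hm := h.angle_mem _ h.right_mem
  refine (Real.Angle.toReal_coe_eq_self_iff.2
    ⟨by linarith [hm.1, Real.pi_pos], by linarith [hm.2, Real.pi_pos]⟩).symm.trans ?_
  rw [beta]
  congr 1
  rw [Real.Angle.coe_add, alpha_coe, ← Real.Angle.coe_add]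
  ring_nf

/-- Angle and curvature bounds at the ends of one segment. -/
theorem Interpolates.segment_bounds (hD : D.Admissible)
    (hspiral : IsSpiral γ θ k (s 1) (s (D.M + 1))) (hint : D.Interpolates s γ θ)
    (h1 : 1 ≤ j) (h2 : j ≤ D.M) :
    D.alpha s θ j ∈ Icc (-(Real.pi / 2)) (Real.pi / 2) ∧
    D.beta s θ j ∈ Icc (-(Real.pi / 2)) (Real.pi / 2) ∧
    0 ≤ D.alpha s θ j + D.beta s θ j ∧
    k (s j) ≤ -(Real.sin (D.alpha s θ j) / D.c j) ∧
    Real.sin (D.beta s θ j) / D.c j ≤ k (s (j + 1)) := by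
  have h := hint.chordSpiral hD hspiral h1 h2
  have hα := h.angle_mem _ h.left_mem
  have hβ := h.angle_mem _ h.right_mem
  have hs := h.angle_add_nonneg
  have hl := h.curv_left_le
  have hr := h.sin_div_le_curv_right
  simp only [sub_self, zero_add, hint.angle_right_eq_beta hD hspiral h1 h2] at hα hβ hs hl hr
  exact ⟨hα, hβ, hs, hl, hr⟩

/-- For `ρ = π` the two half-circle conditions force equal chord lengths, so the second chord
returns to the start of the first, against `ne_succ_succ`. -/
theorem rho_lt_pi (hD : D.Admissible) (h1 : 1 ≤ j) (h2 : j + 1 ≤ D.M) :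
    D.rho (j + 1) < Real.pi := by
  refine lt_of_le_of_ne (Real.Angle.toReal_le_pi _) fun h => ?_
  obtain ⟨g1, g2⟩ := hD.half_circle (j + 1) (by omega) (by omega)
  rw [h, Real.cos_pi, Nat.add_sub_cancel] at g1 g2
  have hc : D.c j = D.c (j + 1) := by linarith
  refine hD.ne_succ_succ (j + 1) (by omega) h2 ?_
  rw [Nat.add_sub_cancel]
  have e1 := chord_eq h1 (by omega : j ≤ D.M)
  have e2 := chord_eq (by omega : 1 ≤ j + 1) h2
  have hr := rho_coe (D := D) (j + 1)
  rw [h, Nat.add_sub_cancel] at hr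
  obtain ⟨n, hn⟩ := Real.Angle.angle_eq_iff_two_pi_dvd_sub.1 hr
  have e3 : Complex.exp (D.mu (j + 1) * Complex.I) = -Complex.exp (D.mu j * Complex.I) := by
    have : (D.mu (j + 1) : ℂ) * Complex.I = D.mu j * Complex.I + Real.pi * Complex.I
        - n * (2 * Real.pi * Complex.I) := by
      have : D.mu (j + 1) = D.mu j + Real.pi - n * (2 * Real.pi) := by linear_combination -hn
      rw [this]; push_cast; ring
    rw [this, Complex.exp_sub, Complex.exp_int_mul_two_pi_mul_I, Complex.exp_add,
      Complex.exp_pi_mul_I]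
    ring
  rw [hc] at e1
  rw [e3] at e2
  linear_combination -e1 - e2

/-- The equality holds modulo `2π`; it is exact because the difference lies in `[-π, π]` and `ρ` is
strictly between `-π` and `π`. -/
theorem Interpolates.beta_sub_alpha_succ (hD : D.Admissible)
    (hspiral : IsSpiral γ θ k (s 1) (s (D.M + 1))) (hint : D.Interpolates s γ θ)
    (h1 : 1 ≤ j) (h2 : j + 1 ≤ D.M) :
    D.beta s θ j - D.alpha s θ (j + 1) = D.rho (j + 1) := by
  obtain ⟨_, hβ, -⟩ := hint.segment_bounds hD hspiral h1 (by omega)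
  obtain ⟨hα, -⟩ := hint.segment_bounds hD hspiral (by omega : 1 ≤ j + 1) h2
  refine eq_of_coe_angle_eq (Real.Angle.neg_pi_lt_toReal _) (rho_lt_pi hD h1 h2)
    ⟨by linarith [hα.2, hβ.1], by linarith [hα.1, hβ.2]⟩ ?_
  rw [Real.Angle.coe_sub, alpha_coe, beta, Real.Angle.coe_toReal, rho_coe, ← Real.Angle.coe_sub,
    Nat.add_sub_cancel]
  ring_nf

/-! ### Circles through three consecutive nodes, and the end tangents -/

theorem xi_mem (hD : D.Admissible) (h1 : 1 ≤ j) (h2 : j ≤ D.M) :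
    D.xi j ∈ Icc (-(Real.pi / 2)) (Real.pi / 2) := by
  rw [mem_Icc, ← abs_le, xi, Complex.abs_arg_le_pi_div_two_iff]
  exact div_nonneg (hD.half_circle j h1 (by omega)).1 (Real.sqrt_nonneg _)

theorem eta_mem (hD : D.Admissible) (h2 : j ≤ D.M) :
    D.eta j ∈ Icc (-(Real.pi / 2)) (Real.pi / 2) := by
  rw [mem_Icc, ← abs_le, eta, Complex.abs_arg_le_pi_div_two_iff]
  have := (hD.half_circle (j + 1) (by omega) (by omega)).2
  rw [Nat.add_sub_cancel] at this
  exact div_nonneg this (Real.sqrt_nonneg _)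

/-- The circular arc through three consecutive points: its tangent at the middle one, and its
curvature. -/
theorem eta_sub_xi (hD : D.Admissible) (h1 : 1 ≤ j) (h2 : j + 1 ≤ D.M) :
    D.eta j - D.xi (j + 1) = D.rho (j + 1) ∧
    Real.sin (D.eta j) / D.c j = -(Real.sin (D.xi (j + 1)) / D.c (j + 1)) := by
  have hc := c_pos hD h1 (by omega)
  have hc' := c_pos hD (by omega : 1 ≤ j + 1) h2
  have hρ := rho_lt_pi hD h1 h2
  have hρ' : -Real.pi < D.rho (j + 1) := Real.Angle.neg_pi_lt_toReal _
  have hξ := xi_mem hD (by omega : 1 ≤ j + 1) h2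
  have hη := eta_mem (j := j) hD (by omega)
  have hsc := Real.sin_sq_add_cos_sq (D.rho (j + 1))
  have hd : 0 < D.d (j + 1) := by
    refine Real.sqrt_pos.2 ?_
    rw [Nat.add_sub_cancel]
    have hcos : -1 < Real.cos (D.rho (j + 1)) := by
      rw [← Real.cos_pi, ← Real.cos_abs (D.rho (j + 1))]
      exact Real.cos_lt_cos_of_nonneg_of_le_pi (abs_nonneg _) le_rfl (abs_lt.2 ⟨hρ', hρ⟩)
    nlinarith [sq_nonneg (D.c j - D.c (j + 1)), mul_pos hc hc']
  have hd2 : D.d (j + 1) ^ 2 = (D.c j + D.c (j + 1) * Real.cos (D.rho (j + 1))) ^ 2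
      + (D.c (j + 1) * Real.sin (D.rho (j + 1))) ^ 2 := by
    have e : (0 : ℝ) ≤ (D.c j + D.c (j + 1) * Real.cos (D.rho (j + 1))) ^ 2
      + (D.c (j + 1) * Real.sin (D.rho (j + 1))) ^ 2 := by positivity
    have e2 : D.c j ^ 2 + 2 * D.c j * D.c (j + 1) * Real.cos (D.rho (j + 1)) + D.c (j + 1) ^ 2
        = (D.c j + D.c (j + 1) * Real.cos (D.rho (j + 1))) ^ 2
      + (D.c (j + 1) * Real.sin (D.rho (j + 1))) ^ 2 := by
      linear_combination (-D.c (j + 1) ^ 2) * hsc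
    rw [d, Nat.add_sub_cancel, e2, Real.sq_sqrt e]
  have hw1 : D.xi (j + 1) = Complex.arg ⟨(D.c j + D.c (j + 1) * Real.cos (D.rho (j + 1))) /
      D.d (j + 1), -(D.c (j + 1) * Real.sin (D.rho (j + 1))) / D.d (j + 1)⟩ := by
    rw [xi, Nat.add_sub_cancel]
  have hw2 : D.eta j = Complex.arg ⟨(D.c (j + 1) + D.c j * Real.cos (D.rho (j + 1))) / D.d (j + 1),
      D.c j * Real.sin (D.rho (j + 1)) / D.d (j + 1)⟩ := rfl
  set w₁ : ℂ := ⟨(D.c j + D.c (j + 1) * Real.cos (D.rho (j + 1))) /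
      D.d (j + 1), -(D.c (j + 1) * Real.sin (D.rho (j + 1))) / D.d (j + 1)⟩ with hw₁
  set w₂ : ℂ := ⟨(D.c (j + 1) + D.c j * Real.cos (D.rho (j + 1))) / D.d (j + 1),
      D.c j * Real.sin (D.rho (j + 1)) / D.d (j + 1)⟩ with hw₂
  -- `w₁` and `w₂` are the same tangent direction seen from two neighbouring chords, hence differ by
  -- the rotation through `ρ`.
  have hmul : w₂ = w₁ * Complex.exp (D.rho (j + 1) * Complex.I) := by
    apply Complex.ext
    · rw [Complex.mul_re, Complex.exp_ofReal_mul_I_re, Complex.exp_ofReal_mul_I_im]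
      simp only [hw₁, hw₂]
      field_simp
      linear_combination (-D.c (j + 1)) * hsc
    · rw [Complex.mul_im, Complex.exp_ofReal_mul_I_re, Complex.exp_ofReal_mul_I_im]
      simp only [hw₁, hw₂]
      field_simp
      ring
  have hn1 : ‖w₁‖ = 1 := by
    rw [← sq_eq_sq₀ (norm_nonneg _) zero_le_one, Complex.sq_norm, Complex.normSq_apply]
    simp only [hw₁]
    field_simp
    linear_combination -hd2
  have hn2 : ‖w₂‖ = 1 := by
    rw [hmul, norm_mul, hn1, Complex.norm_exp_ofReal_mul_I, one_mul]
  refine ⟨eq_of_coe_angle_eq hρ' hρ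
    ⟨by linarith [hξ.2, hη.1], by linarith [hξ.1, hη.2]⟩ ?_, ?_⟩
  · rw [Real.Angle.coe_sub, hw1, hw2, hmul, Complex.arg_mul_coe_angle
      (norm_ne_zero_iff.1 (by rw [hn1]; norm_num)) (Complex.exp_ne_zero _), add_sub_cancel_left,
      Complex.arg_exp_mul_I, ← Real.Angle.toReal_coe, Real.Angle.coe_toReal]
  · rw [hw1, hw2, Complex.sin_arg, Complex.sin_arg, hn1, hn2]
    simp only [hw₁, hw₂]
    field_simp

/-- If `α_{j+1}` exceeded `ξ_{j+1}`, then `β_j` would exceed `η_j` by the same amount. The node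
curvature would then have to be at least the curvature of the circle through the three nodes, by the
left segment, and strictly less, by the right one. -/
theorem Interpolates.node_bounds (hD : D.Admissible)
    (hspiral : IsSpiral γ θ k (s 1) (s (D.M + 1))) (hint : D.Interpolates s γ θ)
    (h1 : 1 ≤ j) (h2 : j + 1 ≤ D.M) :
    D.alpha s θ (j + 1) ≤ D.xi (j + 1) ∧ D.beta s θ j ≤ D.eta j := by
  obtain ⟨e1, e2⟩ := eta_sub_xi hD h1 h2
  have e3 := hint.beta_sub_alpha_succ hD hspiral h1 h2
  obtain ⟨_, hβ, -, -, hr⟩ := hint.segment_bounds hD hspiral h1 (by omega)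
  obtain ⟨hα, -, -, hl, -⟩ := hint.segment_bounds hD hspiral (by omega : 1 ≤ j + 1) h2
  have hξ := xi_mem hD (by omega : 1 ≤ j + 1) h2
  have hη := eta_mem (j := j) hD (by omega)
  suffices D.alpha s θ (j + 1) ≤ D.xi (j + 1) from ⟨this, by linarith⟩
  by_contra! h
  have g1 := Real.sin_lt_sin_of_lt_of_le_pi_div_two hξ.1 hα.2 h
  have g2 := Real.sin_le_sin_of_le_of_le_pi_div_two hη.1 hβ.2 (by linarith)
  have g3 := div_lt_div_of_pos_right g1 (c_pos hD (by omega : 1 ≤ j + 1) h2)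
  have g4 := div_le_div_of_nonneg_right g2 (c_pos hD h1 (by omega)).le
  linarith

theorem Interpolates.alpha_one (hD : D.Admissible) (hint : D.Interpolates s γ θ) :
    D.alpha s θ 1 = D.xi 1 := by
  have h1 := hD.one_le
  have hc := c_pos hD le_rfl h1
  have hc0 : D.c 0 = 0 := by simp [c]
  obtain ⟨g, -⟩ := hD.half_circle 1 le_rfl (by omega)
  rw [Nat.sub_self, hc0, zero_add] at g
  have hcos := nonneg_of_mul_nonneg_right g hc
  have hd : D.d 1 = D.c 1 := by simp [d, hc0, hc.le]
  -- With `c_0 = 0` the three-point circle degenerates and `ξ_1 = -ρ_1`; the half-circle condition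
  -- then gives `cos ρ_1 ≥ 0`, which excludes `ρ_1 = π`.
  have hx : D.xi 1 = Complex.arg ⟨Real.cos (-D.rho 1), Real.sin (-D.rho 1)⟩ := by
    rw [xi, hd, Nat.sub_self, hc0, zero_add, mul_div_cancel_left₀ _ hc.ne', neg_div,
      mul_div_cancel_left₀ _ hc.ne', Real.cos_neg, Real.sin_neg]
  have hpi : D.rho 1 ≠ Real.pi := fun h => by
    rw [h, Real.cos_pi] at hcos; linarith
  have hlt : D.rho 1 < Real.pi := lt_of_le_of_ne (Real.Angle.toReal_le_pi _) hpi
  have hgt : -Real.pi < D.rho 1 := Real.Angle.neg_pi_lt_toReal _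
  rw [hx, arg_mk_cos_sin ⟨by linarith, by linarith⟩]
  refine eq_of_coe_angle_eq (by linarith) (by linarith) ⟨(Real.Angle.neg_pi_lt_toReal _).le,
    Real.Angle.toReal_le_pi _⟩ ?_
  rw [alpha_coe, Real.Angle.coe_neg, rho_coe, ← Real.Angle.coe_neg, Real.Angle.coe_sub,
    hint.first_tangent, ← Real.Angle.coe_sub]
  simp [mu]

theorem Interpolates.beta_last (hD : D.Admissible) (hint : D.Interpolates s γ θ) :
    D.beta s θ D.M = D.eta D.M := by
  have h1 := hD.one_le
  have hc := c_pos hD h1 le_rfl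
  have hc0 : D.c (D.M + 1) = 0 := by simp [c]
  have hd : D.d (D.M + 1) = D.c D.M := by simp [d, hc0, hc.le]
  have hx : D.eta D.M = Complex.arg ⟨Real.cos (D.rho (D.M + 1)), Real.sin (D.rho (D.M + 1))⟩ := by
    rw [eta, hd, hc0, zero_add, mul_div_cancel_left₀ _ hc.ne', mul_div_cancel_left₀ _ hc.ne']
  have hρ : D.rho (D.M + 1) ∈ Ioc (-Real.pi) Real.pi :=
    ⟨Real.Angle.neg_pi_lt_toReal _, Real.Angle.toReal_le_pi _⟩
  rw [hx, arg_mk_cos_sin hρ, beta, rho]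
  congr 1
  rw [Real.Angle.coe_sub, hint.last_tangent, ← Real.Angle.coe_sub]
  simp [mu]

/-! ### The ranges of the table -/

theorem Interpolates.alpha_le_xi (hD : D.Admissible)
    (hspiral : IsSpiral γ θ k (s 1) (s (D.M + 1))) (hint : D.Interpolates s γ θ)
    (h1 : 1 ≤ j) (h2 : j ≤ D.M) : D.alpha s θ j ≤ D.xi j := by
  rcases h1.eq_or_lt with rfl | h
  · exact (hint.alpha_one hD).le
  · obtain ⟨i, rfl⟩ : ∃ i, j = i + 1 := ⟨j - 1, by omega⟩
    exact (hint.node_bounds hD hspiral (by omega) h2).1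

theorem Interpolates.beta_le_eta (hD : D.Admissible)
    (hspiral : IsSpiral γ θ k (s 1) (s (D.M + 1))) (hint : D.Interpolates s γ θ)
    (h1 : 1 ≤ j) (h2 : j ≤ D.M) : D.beta s θ j ≤ D.eta j := by
  rcases h2.eq_or_lt with rfl | h
  · exact (hint.beta_last hD).le
  · exact (hint.node_bounds hD hspiral h1 h).2

/-- Vogt's inequality on the same segment gives `α_j ≥ -β_j ≥ -η_j`; on the preceding one it gives
`α_j = β_{j-1} - ρ_j ≥ -ξ_{j-1} - ρ_j`. -/
theorem Interpolates.alphaMin_le_alpha (hD : D.Admissible)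
    (hspiral : IsSpiral γ θ k (s 1) (s (D.M + 1))) (hint : D.Interpolates s γ θ)
    (h1 : 1 ≤ j) (h2 : j ≤ D.M) : D.alphaMin j ≤ D.alpha s θ j := by
  obtain ⟨-, -, hsum, -⟩ := hint.segment_bounds hD hspiral h1 h2
  unfold alphaMin
  split_ifs with h
  · subst h; exact (hint.alpha_one hD).ge
  · obtain ⟨i, rfl⟩ : ∃ i, j = i + 1 := ⟨j - 1, by omega⟩
    rw [Nat.add_sub_cancel]
    have e := hint.beta_sub_alpha_succ hD hspiral (by omega : 1 ≤ i) h2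
    have := hint.alpha_le_xi hD hspiral (by omega : 1 ≤ i) (by omega)
    obtain ⟨-, -, hsum', -⟩ := hint.segment_bounds hD hspiral (by omega : 1 ≤ i) (by omega)
    refine max_le (by linarith) ?_
    linarith [hint.beta_le_eta hD hspiral h1 h2]

theorem Interpolates.betaMin_le_beta (hD : D.Admissible)
    (hspiral : IsSpiral γ θ k (s 1) (s (D.M + 1))) (hint : D.Interpolates s γ θ)
    (h1 : 1 ≤ j) (h2 : j ≤ D.M) : D.betaMin j ≤ D.beta s θ j := by
  obtain ⟨-, -, hsum, -⟩ := hint.segment_bounds hD hspiral h1 h2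
  unfold betaMin
  split_ifs with h
  · subst h; exact (hint.beta_last hD).ge
  · have e := hint.beta_sub_alpha_succ hD hspiral h1 (by omega)
    have := hint.beta_le_eta hD hspiral (by omega : 1 ≤ j + 1) (by omega)
    obtain ⟨-, -, hsum', -⟩ := hint.segment_bounds hD hspiral (by omega : 1 ≤ j + 1) (by omega)
    refine max_le ?_ (by linarith)
    linarith [hint.alpha_le_xi hD hspiral h1 h2]

/-- For `j > 1` this is built into the maximum; for `j = 1` the prescribed angle is `α_1` itself and
Vogt's inequality applies. -/
theorem Interpolates.neg_eta_le_alphaMin (hD : D.Admissible)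
    (hspiral : IsSpiral γ θ k (s 1) (s (D.M + 1))) (hint : D.Interpolates s γ θ)
    (h1 : 1 ≤ j) (h2 : j ≤ D.M) : -D.eta j ≤ D.alphaMin j := by
  unfold alphaMin
  split_ifs with h
  · subst h
    obtain ⟨-, -, hsum, -⟩ := hint.segment_bounds hD hspiral h1 h2
    linarith [hint.alpha_one hD, hint.beta_le_eta hD hspiral h1 h2]
  · exact le_max_right _ _

theorem Interpolates.neg_xi_le_betaMin (hD : D.Admissible)
    (hspiral : IsSpiral γ θ k (s 1) (s (D.M + 1))) (hint : D.Interpolates s γ θ)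
    (h1 : 1 ≤ j) (h2 : j ≤ D.M) : -D.xi j ≤ D.betaMin j := by
  unfold betaMin
  split_ifs with h
  · subst h
    obtain ⟨-, -, hsum, -⟩ := hint.segment_bounds hD hspiral h1 h2
    linarith [hint.beta_last hD, hint.alpha_le_xi hD hspiral h1 h2]
  · exact le_max_left _ _

theorem Interpolates.alphaMin_mem (hD : D.Admissible)
    (hspiral : IsSpiral γ θ k (s 1) (s (D.M + 1))) (hint : D.Interpolates s γ θ)
    (h1 : 1 ≤ j) (h2 : j ≤ D.M) : D.alphaMin j ∈ Icc (-(Real.pi / 2)) (Real.pi / 2) := by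
  obtain ⟨hα, -⟩ := hint.segment_bounds hD hspiral h1 h2
  exact ⟨by linarith [hint.neg_eta_le_alphaMin hD hspiral h1 h2, (eta_mem hD h2).2],
    (hint.alphaMin_le_alpha hD hspiral h1 h2).trans hα.2⟩

theorem Interpolates.betaMin_mem (hD : D.Admissible)
    (hspiral : IsSpiral γ θ k (s 1) (s (D.M + 1))) (hint : D.Interpolates s γ θ)
    (h1 : 1 ≤ j) (h2 : j ≤ D.M) : D.betaMin j ∈ Icc (-(Real.pi / 2)) (Real.pi / 2) := by
  obtain ⟨-, hβ, -⟩ := hint.segment_bounds hD hspiral h1 h2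
  exact ⟨by linarith [hint.neg_xi_le_betaMin hD hspiral h1 h2, (xi_mem hD h1 h2).2],
    (hint.betaMin_le_beta hD hspiral h1 h2).trans hβ.2⟩

/-- The lower curvature bound is either `-∞`, or a real number not above the initial curvature. -/
theorem Interpolates.curvMin_cases (hD : D.Admissible)
    (hspiral : IsSpiral γ θ k (s 1) (s (D.M + 1))) (hint : D.Interpolates s γ θ)
    (h1 : 1 ≤ j) (h2 : j ≤ D.M) :
    D.curvMin j = ⊥ ∨ ∃ a : ℝ, D.curvMin j = a ∧ a ≤ k (s j) := by
  unfold curvMin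
  split_ifs with h
  · exact .inl rfl
  · obtain ⟨i, rfl⟩ : ∃ i, j = i + 1 := ⟨j - 1, by omega⟩
    rw [Nat.add_sub_cancel]
    refine .inr ⟨_, rfl, ?_⟩
    obtain ⟨-, hβ, -, -, hr⟩ := hint.segment_bounds hD hspiral (by omega : 1 ≤ i) (by omega)
    refine le_trans (div_le_div_of_nonneg_right ?_ (c_nonneg i)) hr
    exact Real.sin_le_sin_of_le_of_le_pi_div_two
      (hint.betaMin_mem hD hspiral (by omega) (by omega)).1 hβ.2
      (hint.betaMin_le_beta hD hspiral (by omega) (by omega))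

/-- The upper curvature bound is either `∞`, or a real number not below the final curvature. -/
theorem Interpolates.curvMax_cases (hD : D.Admissible)
    (hspiral : IsSpiral γ θ k (s 1) (s (D.M + 1))) (hint : D.Interpolates s γ θ)
    (h1 : 1 ≤ j) (h2 : j ≤ D.M) :
    D.curvMax j = ⊤ ∨ ∃ b : ℝ, D.curvMax j = b ∧ k (s (j + 1)) ≤ b := by
  unfold curvMax
  split_ifs with h
  · exact .inl rfl
  · refine .inr ⟨_, rfl, ?_⟩
    obtain ⟨hα, -, -, hl, -⟩ := hint.segment_bounds hD hspiral (by omega : 1 ≤ j + 1) (by omega)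
    refine le_trans hl (neg_le_neg (div_le_div_of_nonneg_right ?_ (c_nonneg _)))
    exact Real.sin_le_sin_of_le_of_le_pi_div_two
      (hint.alphaMin_mem hD hspiral (by omega) (by omega)).1 hα.2
      (hint.alphaMin_le_alpha hD hspiral (by omega) (by omega))

end SplineData

/-! ### Assembling the proposition -/

theorem sin_half_pos {u : ℝ} (h0 : 0 < u) (h1 : u ≤ Real.pi) : 0 < Real.sin (u / 2) :=
  Real.sin_pos_of_pos_of_lt_pi (by linarith) (by linarith [Real.pi_pos])

theorem proposition5 (D : SplineData) (hD : D.Admissible)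
    (s : ℕ → ℝ) (γ : ℝ → ℂ) (θ k : ℝ → ℝ)
    (hspiral : IsSpiral γ θ k (s 1) (s (D.M + 1)))
    (hint : D.Interpolates s γ θ)
    (f : ℕ → ℝ → ℝ)
    (hf : ∀ j, 1 ≤ j → j ≤ D.M → ∀ t ∈ Set.Icc (s j) (s (j + 1)),
      f j (D.toLocal j (γ t)).re = (D.toLocal j (γ t)).im) :
    ∀ j, 1 ≤ j → j ≤ D.M →
      -- the tangent ranges and the curvature ranges
      (D.alphaMin j ≤ D.alpha s θ j ∧ D.alpha s θ j ≤ D.alphaMax j) ∧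
      (D.betaMin j ≤ D.beta s θ j ∧ D.beta s θ j ≤ D.betaMax j) ∧
      (∀ t ∈ Set.Icc (s j) (s (j + 1)),
        D.curvMin j ≤ (k t : EReal) ∧ (k t : EReal) ≤ D.curvMax j) ∧
      -- the parameters are those of (possibly degenerate) short biarcs
      (|D.alphaMin j| ≤ Real.pi / 2 ∧ |D.alphaMax j| ≤ Real.pi / 2 ∧
        |D.betaMin j| ≤ Real.pi / 2 ∧ |D.betaMax j| ≤ Real.pi / 2) ∧
      (0 ≤ D.alphaMin j + D.betaMax j ∧ 0 ≤ D.alphaMax j + D.betaMin j) ∧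
      D.curvMin j * (D.c j : EReal) + (Real.sin (D.alphaMin j) : EReal) ≤ 0 ∧
      0 ≤ D.curvMax j * (D.c j : EReal) - (Real.sin (D.betaMin j) : EReal) ∧
      -- the bounds
      ∀ x ∈ Set.Icc (-D.c j) (D.c j),
        shortBiarc (D.c j) (D.alphaMin j) (D.betaMax j) (D.pLower j) x ≤ f j x ∧
        f j x ≤ shortBiarc (D.c j) (D.alphaMax j) (D.betaMin j) (D.pUpper j) x := by
  intro j h1 h2
  have hS := hint.chordSpiral hD hspiral h1 h2
  obtain ⟨hα, hβ, hsum, hl, hr⟩ := hint.segment_bounds hD hspiral h1 h2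
  have hc := D.c_pos hD h1 h2
  have hξ := D.xi_mem hD h1 h2
  have hη := D.eta_mem hD h2
  have hα' := hint.alphaMin_mem hD hspiral h1 h2
  have hβ' := hint.betaMin_mem hD hspiral h1 h2
  have hαle := hint.alphaMin_le_alpha hD hspiral h1 h2
  have hβle := hint.betaMin_le_beta hD hspiral h1 h2
  have hleξ := hint.alpha_le_xi hD hspiral h1 h2
  have hleη := hint.beta_le_eta hD hspiral h1 h2
  have hω' := hint.neg_eta_le_alphaMin hD hspiral h1 h2
  have hω'' := hint.neg_xi_le_betaMin hD hspiral h1 h2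
  have hl' : k (s j) * D.c j + Real.sin (D.alphaMin j) ≤ 0 := by
    have := Real.sin_le_sin_of_le_of_le_pi_div_two hα'.1 hα.2 hαle
    have h3 : k (s j) * D.c j ≤ -(Real.sin (D.alpha s θ j)) := by
      rw [← neg_div, le_div_iff₀ hc] at hl; exact hl
    linarith
  have hr' : 0 ≤ k (s (j + 1)) * D.c j - Real.sin (D.betaMin j) := by
    have := Real.sin_le_sin_of_le_of_le_pi_div_two hβ'.1 hβ.2 hβle
    rw [div_le_iff₀ hc] at hr
    linarith
  have hmin := hint.curvMin_cases hD hspiral h1 h2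
  have hmax := hint.curvMax_cases hD hspiral h1 h2
  refine ⟨⟨hαle, hleξ⟩, ⟨hβle, hleη⟩, fun t ht => ⟨?_, ?_⟩, ⟨abs_le.2 hα', abs_le.2 hξ, abs_le.2 hβ',
    abs_le.2 hη⟩, ⟨by unfold SplineData.betaMax; linarith, by unfold SplineData.alphaMax; linarith⟩,
    ?_, ?_, fun x hx => ?_⟩
  · rcases hmin with h | ⟨a, h, ha⟩ <;> rw [h]
    · exact bot_le
    · exact EReal.coe_le_coe_iff.2 (ha.trans (hS.monotone hS.left_mem ht ht.1))
  · rcases hmax with h | ⟨b, h, hb⟩ <;> rw [h]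
    · exact le_top
    · exact EReal.coe_le_coe_iff.2 ((hS.monotone ht hS.right_mem ht.2).trans hb)
  · rcases hmin with h | ⟨a, h, ha⟩ <;> rw [h]
    · rw [EReal.bot_mul_coe_of_pos hc, EReal.bot_add]; exact bot_le
    · rw [← EReal.coe_mul, ← EReal.coe_add]
      exact_mod_cast (by nlinarith : a * D.c j + Real.sin (D.alphaMin j) ≤ 0)
  · rcases hmax with h | ⟨b, h, hb⟩ <;> rw [h]
    · rw [EReal.top_mul_coe_of_pos hc, EReal.top_sub_coe]; exact le_top
    · rw [← EReal.coe_mul, ← EReal.coe_sub]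
      exact_mod_cast (by nlinarith : 0 ≤ b * D.c j - Real.sin (D.betaMin j))
  -- The projection of the segment covers the whole chord, so the bounds may be checked at points of
  -- the curve.
  · obtain ⟨t, ht, rfl⟩ : ∃ t ∈ Icc (s j) (s (j + 1)), (D.toLocal j (γ t)).re = x := by
      have := intermediate_value_Icc hS.lt.le
        fun t ht => (hS.x_deriv t ht).continuousWithinAt
      rw [hS.x_left, hS.x_right] at this
      exact this hx
    rw [hf j h1 h2 t ht]
    have eα : D.alpha s θ j = θ (s j) - θ (s j) + D.alpha s θ j := by ring
    have eβ := hint.angle_right_eq_beta hD hspiral h1 h2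
    constructor
    · refine hS.shortBiarc_le hα' hη (by linarith) (eα ▸ hαle) (eβ ▸ hleη) (fun h0 hp => ?_)
        (fun h0 hp hp' => ?_) ht
      all_goals
        have hs := sin_half_pos (lt_of_le_of_ne (by linarith) (Ne.symm h0))
          (by linarith [hα'.2, hη.2])
        simp only [SplineData.pLower, SplineData.betaMax] at hp ⊢
        rcases hmin with h | ⟨a, h, ha⟩
      -- For `a_j = -∞` the denominator is `∞`, so `p' = 0` and only the arc with end tangent `β''`
      -- is compared.
      · rw [h, EReal.bot_mul_coe_of_pos hc, EReal.bot_add, EReal.neg_bot, EReal.toENNReal_top,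
          ENNReal.div_top] at hp
        exact absurd hp ENNReal.zero_ne_top
      · rw [h, ← EReal.coe_mul, ← EReal.coe_add, ← EReal.coe_neg,
          EReal.toENNReal_of_ne_top (EReal.coe_ne_top _), EReal.toReal_coe] at hp
        -- `p' = ∞` means that the truncated denominator is zero, that is, `a_j` is at least the
        -- curvature `-sin α' / c` of the single arc.
        have h3 := (ENNReal.div_eq_top.1 hp).resolve_right fun h4 => ENNReal.ofReal_ne_top h4.1
        have h5 := ENNReal.ofReal_eq_zero.1 h3.2
        refine le_trans ?_ ha
        rw [← neg_div, div_le_iff₀ hc]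
        linarith
      · rw [h, EReal.bot_mul_coe_of_pos hc, EReal.bot_add, EReal.neg_bot, EReal.toENNReal_top,
          ENNReal.div_top] at hp
        exact absurd rfl hp
      · simp only [SplineData.pLower, SplineData.betaMax] at hp'
        rw [h, ← EReal.coe_mul, ← EReal.coe_add, ← EReal.coe_neg,
          EReal.toENNReal_of_ne_top (EReal.coe_ne_top _), EReal.toReal_coe] at hp' ⊢
        have h3 : 0 < -(a * D.c j + Real.sin (D.alphaMin j)) := by
          by_contra! h4
          refine hp' (ENNReal.div_eq_top.2 (.inl ⟨?_, ENNReal.ofReal_eq_zero.2 h4⟩))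
          exact (ENNReal.ofReal_pos.2 hs).ne'
        rw [← ENNReal.ofReal_div_of_pos h3, ENNReal.toReal_ofReal (by positivity)]
        -- For finite positive `p'` the start curvature of the biarc is exactly `a_j`.
        refine le_trans (le_of_eq ?_) ha
        unfold biarcStartCurv
        rw [div_div_cancel₀ hs.ne']
        field_simp
        ring
    · refine hS.le_shortBiarc hξ hβ' (by linarith) (eα ▸ hleξ) (eβ ▸ hβle) (fun h0 hp => ?_)
        (fun h0 hp hp' => ?_) ht
      all_goals
        have hs := sin_half_pos (lt_of_le_of_ne (by linarith) (Ne.symm h0))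
          (by linarith [hξ.2, hβ'.2])
        simp only [SplineData.pUpper, SplineData.alphaMax] at hp ⊢
        rcases hmax with h | ⟨b, h, hb⟩
      · rw [h, EReal.top_mul_coe_of_pos hc, EReal.top_sub_coe, EReal.toENNReal_top,
          ENNReal.top_div_of_ne_top ENNReal.ofReal_ne_top] at hp
        exact absurd hp ENNReal.top_ne_zero
      · rw [h, ← EReal.coe_mul, ← EReal.coe_sub,
          EReal.toENNReal_of_ne_top (EReal.coe_ne_top _), EReal.toReal_coe] at hp
        have h3 := (ENNReal.div_eq_zero_iff.1 hp).resolve_right ENNReal.ofReal_ne_top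
        have h5 := ENNReal.ofReal_eq_zero.1 h3
        refine le_trans hb ?_
        rw [le_div_iff₀ hc]
        linarith
      · simp only [SplineData.pUpper, SplineData.alphaMax] at hp'
        rw [h, EReal.top_mul_coe_of_pos hc, EReal.top_sub_coe, EReal.toENNReal_top,
          ENNReal.top_div_of_ne_top ENNReal.ofReal_ne_top] at hp'
        exact absurd rfl hp'
      · rw [h, ← EReal.coe_mul, ← EReal.coe_sub,
          EReal.toENNReal_of_ne_top (EReal.coe_ne_top _), EReal.toReal_coe] at hp ⊢
        have h3 : 0 < b * D.c j - Real.sin (D.betaMin j) := by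
          by_contra! h4
          exact hp (ENNReal.div_eq_zero_iff.2 (.inl (ENNReal.ofReal_eq_zero.2 h4)))
        rw [← ENNReal.ofReal_div_of_pos hs, ENNReal.toReal_ofReal (by positivity)]
        -- Symmetrically, `p''` makes the end curvature of the biarc exactly `b_j`.
        refine le_trans hb (le_of_eq ?_)
        unfold biarcEndCurv
        rw [div_mul_cancel₀ _ hs.ne']
        field_simp
        ring
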